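/- **Theorem 1.8.** Work over $\mathbb C$. Let $X\subset\mathbb P^n$ be a Zariski closed subset (a reduced, possibly reducible, projective variety), let $x\in X$ be a singular point (the local ring $\mathcal O_{X,x}$ is not regular), let $r\ge 2$ and let $d\ge 2r-1$ be integers. Notation. $\langle A\rangle$ is the linear span of a set $A$ of points of a projective space. $v_d:\mathbb P^n\to\mathbb P^{\binom{n+d}{d}-1}$ is the $d$-th Veronese embedding, given by all monomials of degree $d$ in the homogeneous coordinates. The $r$-th secant variety $\sigma_r(Y)$ of a subset $Y$ of a projective space is the Zariski closure of $\bigcup_{y_1,\dots,y_r\in Y}\langle y_1,\dots,y_r\rangle$. The tangent star of $X$ at $x$ is $$T^{\star}_xX=\{z\in\mathbb P^n : (x,x,z)\in S_X\},\qquad S_X=\overline{\{(a,b,z)\in X\times X\times\mathbb P^n : z\in\langle a,b\rangle\}},$$ the bar being Zariski closure in $\mathbb P^n\times\mathbb P^n\times\mathbb P^n$. For $q\in\mathbb N$ let $Z_q\subset\langle T^{\star}_xX\rangle$ be the (reduced) zero locus of all homogeneous forms of degree $\le q$ that vanish on $T^{\star}_xX$. 1. If $T^{\star}_xX\ne\langle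 T^{\star}_xX\rangle$, then $$\sigma_r(v_d(X))\ne\bigl(\sigma_r(v_d(\mathbb P^n))\cap\langle v_d(X)\rangle\bigr)_{\mathrm{red}},$$ that is, the two sides are different as sets of points. 2. Let $q\in\mathbb N$. If $T^{\star}_xX$ is not a union of irreducible components of $Z_q$ (for irreducible $T^{\star}_xX$: if no irreducible component of $Z_q$ is equal to $T^{\star}_xX$), then $\sigma_r(v_d(X))$ is not the common zero set of any family of homogeneous polynomials of degree $\le q$. 3. The hypothesis of 2 holds, for instance, if every form of degree $\le q$ vanishing on $T^{\star}_xX$ vanishes on $\langle T^{\star}_xX\rangle$, and $T^{\star}_xX\ne\langle T^{\star}_xX\rangle$. -/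

import Mathlib

open scoped LinearAlgebra.Projectivization

/-- The complex projective space with homogeneous coordinates indexed by `ι`
(so `CProj (Fin (n + 1))` is `ℙⁿ`). -/
abbrev CProj (ι : Type) : Type := ℙ ℂ (ι → ℂ)

/-- A polynomial vanishes at (the chosen representative of) a point of projective space.
It is only used for homogeneous polynomials, where the representative does not matter. -/
def VanishesAt {ι : Type} (F : MvPolynomial ι ℂ) (p : CProj ι) : Prop :=
  MvPolynomial.eval p.rep F = 0

theorem vanishesAt_mk {ι : Type} {F : MvPolynomial ι ℂ} {k : ℕ} (hF : F.IsHomogeneous k)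
    (v : ι → ℂ) (hv : v ≠ 0) :
    VanishesAt F (Projectivization.mk ℂ v hv) ↔ MvPolynomial.eval v F = 0 := by
  obtain ⟨a, ha⟩ := Projectivization.exists_smul_eq_mk_rep ℂ v hv
  have h : MvPolynomial.eval (a • v) F = (a : ℂ) ^ k * MvPolynomial.eval v F := by
    rw [MvPolynomial.eval_eq, MvPolynomial.eval_eq, Finset.mul_sum]
    refine Finset.sum_congr rfl fun m hm => ?_
    have hdeg : ∑ i ∈ m.support, m i = k := by
      have := hF (MvPolynomial.mem_support_iff.mp hm)
      simpa [Finsupp.weight_apply, Finsupp.sum] using this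
    simp only [Units.smul_def, Pi.smul_apply, smul_eq_mul, mul_pow, Finset.prod_mul_distrib,
      Finset.prod_pow_eq_pow_sum, hdeg]
    ring
  unfold VanishesAt
  rw [← ha, h]
  simp

/-- The common zero set in projective space of a set of polynomials. -/
def projZeroLocus {ι : Type} (S : Set (MvPolynomial ι ℂ)) : Set (CProj ι) :=
  {p | ∀ F ∈ S, VanishesAt F p}

/-- The Zariski topology on projective space: the closed sets are the zero loci of sets of
homogeneous polynomials. -/
instance zariskiTopology (ι : Type) : TopologicalSpace (CProj ι) :=
  TopologicalSpace.ofClosed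
    {Z | ∃ S : Set (MvPolynomial ι ℂ), (∀ F ∈ S, ∃ k, F.IsHomogeneous k) ∧ Z = projZeroLocus S}
    (by
      refine ⟨{1}, ?_, ?_⟩
      · rintro F rfl
        exact ⟨0, MvPolynomial.isHomogeneous_one _ _⟩
      · ext p
        simp [projZeroLocus, VanishesAt])
    (by
      intro A hA
      refine ⟨{F | (∃ k, F.IsHomogeneous k) ∧ ∃ Z ∈ A, ∀ p ∈ Z, VanishesAt F p},
        fun F hF => hF.1, ?_⟩
      ext p
      constructor
      · rintro hp F ⟨-, Z, hZ, h⟩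
        exact h p (hp Z hZ)
      · intro hp Z hZ
        obtain ⟨S, hS, hZS⟩ := hA hZ
        rw [hZS]
        intro F hF
        refine hp F ⟨hS F hF, Z, hZ, fun a ha => ?_⟩
        rw [hZS] at ha
        exact ha F hF)
    (by
      rintro _ ⟨S, hS, rfl⟩ _ ⟨T, hT, rfl⟩
      refine ⟨{H | ∃ F ∈ S, ∃ G ∈ T, H = F * G}, ?_, ?_⟩
      · rintro _ ⟨F, hF, G, hG, rfl⟩
        obtain ⟨k, hk⟩ := hS F hF
        obtain ⟨l, hl⟩ := hT G hG
        exact ⟨k + l, hk.mul hl⟩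
      · ext p
        constructor
        · rintro (hp | hp) _ ⟨F, hF, G, hG, rfl⟩
          · have := hp F hF
            simp_all [VanishesAt]
          · have := hp G hG
            simp_all [VanishesAt]
        · intro hp
          by_contra hcon
          simp only [Set.mem_union, not_or, projZeroLocus, Set.mem_ofPred_eq, not_forall] at hcon
          obtain ⟨⟨F, hF, hFp⟩, G, hG, hGp⟩ := hcon
          have := hp _ ⟨F, hF, G, hG, rfl⟩
          simp_all [VanishesAt])

theorem zariski_isClosed_iff {ι : Type} (Z : Set (CProj ι)) :
    IsClosed Z ↔ ∃ S : Set (MvPolynomial ι ℂ),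
      (∀ F ∈ S, ∃ k, F.IsHomogeneous k) ∧ Z = projZeroLocus S :=
  by
  rw [← isOpen_compl_iff]
  change Zᶜᶜ ∈ _ ↔ _
  rw [compl_compl]
  rfl

/-- The linear span of a set of points of projective space, as a set of points. -/
def linSpan {ι : Type} (A : Set (CProj ι)) : Set (CProj ι) :=
  (Projectivization.Subspace.span A : Set (CProj ι))

/-- The `r`-th secant variety: the Zariski closure of the union of the linear spans of `r`
points (not necessarily distinct) of `Y`. -/
def secantVariety {ι : Type} (r : ℕ) (Y : Set (CProj ι)) : Set (CProj ι) :=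
  closure {p | ∃ y : Fin r → CProj ι, (∀ i, y i ∈ Y) ∧ p ∈ linSpan (Set.range y)}

/-- The vector of all monomials of degree `d` in the coordinates of `v`
(the monomials of degree `d` are indexed by the multisets of `d` indices). -/
def veroneseVec {ι : Type} (d : ℕ) (v : ι → ℂ) : Sym ι d → ℂ :=
  fun m => ((m : Multiset ι).map v).prod

theorem veroneseVec_ne_zero {ι : Type} (d : ℕ) {v : ι → ℂ} (hv : v ≠ 0) :
    veroneseVec d v ≠ 0 := by
  obtain ⟨i, hi⟩ := Function.ne_iff.mp hv
  intro h
  have := congrFun h (Sym.replicate d i)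
  simp [veroneseVec, Sym.coe_replicate] at this
  exact hi this.1

theorem veroneseVec_smul {ι : Type} (d : ℕ) (a : ℂ) (v : ι → ℂ) :
    veroneseVec d (a • v) = a ^ d • veroneseVec d v := by
  funext m
  simp [veroneseVec, Multiset.prod_map_mul]

/-- The `d`-th Veronese embedding `[v] ↦ [all monomials of degree d in v]`. -/
noncomputable def veronese {ι : Type} (d : ℕ) (p : CProj ι) : CProj (Sym ι d) :=
  Projectivization.mk ℂ (veroneseVec d p.rep) (veroneseVec_ne_zero d p.rep_nonzero)

theorem veronese_mk {ι : Type} (d : ℕ) (v : ι → ℂ) (hv : v ≠ 0) :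
    veronese d (Projectivization.mk ℂ v hv) =
      Projectivization.mk ℂ (veroneseVec d v) (veroneseVec_ne_zero d hv) := by
  obtain ⟨a, ha⟩ := Projectivization.exists_smul_eq_mk_rep ℂ v hv
  rw [veronese, Projectivization.mk_eq_mk_iff']
  refine ⟨(a : ℂ) ^ d, ?_⟩
  rw [← ha, Units.smul_def, veroneseVec_smul]

/-- The Zariski closure in a product of projective spaces: the common zeros of all multihomogeneous
polynomials that vanish on `A`.  The variable `(j, i)` is the `i`-th homogeneous coordinate of
the `j`-th factor, and its weight is the `j`-th unit vector. -/
def multiZariskiClosure {κ ι : Type} [DecidableEq κ] (A : Set (κ → CProj ι)) :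
    Set (κ → CProj ι) :=
  {p | ∀ (m : κ → ℕ) (G : MvPolynomial (κ × ι) ℂ),
    MvPolynomial.IsWeightedHomogeneous (fun ji : κ × ι => (Pi.single ji.1 1 : κ → ℕ)) G m →
    (∀ a ∈ A, MvPolynomial.eval (fun ji => (a ji.1).rep ji.2) G = 0) →
      MvPolynomial.eval (fun ji => (p ji.1).rep ji.2) G = 0}

/-- The incidence correspondence: the Zariski closure of the set of triples `(x, y, z)` with
`x, y ∈ X` and `z ∈ ⟨x, y⟩`. -/
def secantIncidence {ι : Type} (X : Set (CProj ι)) : Set (Fin 3 → CProj ι) :=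
  multiZariskiClosure {a | a 0 ∈ X ∧ a 1 ∈ X ∧ a 2 ∈ linSpan {a 0, a 1}}

/-- The tangent star of `X` at `x`: the points `z` such that `(x, x, z)` lies in the
incidence correspondence. -/
def tangentStar {ι : Type} (X : Set (CProj ι)) (x : CProj ι) : Set (CProj ι) :=
  {z | ![x, x, z] ∈ secantIncidence X}

/-- The homogeneous ideal of a set of points of projective space. -/
noncomputable def homogIdeal {ι : Type} (X : Set (CProj ι)) : Ideal (MvPolynomial ι ℂ) :=
  Ideal.span {F | (∃ k, F.IsHomogeneous k) ∧ ∀ p ∈ X, VanishesAt F p}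

/-- The homogeneous prime ideal of a point `[v]`: the polynomials that vanish on the line `ℂ v`. -/
noncomputable def pointIdeal {ι : Type} (x : CProj ι) : Ideal (MvPolynomial ι ℂ) :=
  RingHom.ker (MvPolynomial.aeval
    (fun i => Polynomial.C (x.rep i) * Polynomial.X) : MvPolynomial ι ℂ →ₐ[ℂ] Polynomial ℂ)

instance pointIdeal_isPrime {ι : Type} (x : CProj ι) : (pointIdeal x).IsPrime :=
  RingHom.ker_isPrime _

attribute [local instance] MvPolynomial.gradedAlgebra

/-- The local ring `𝒪_{ℙ,x}` of projective space at `x`. -/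
abbrev AmbientLocalRing {ι : Type} (x : CProj ι) : Type :=
  HomogeneousLocalization.AtPrime (MvPolynomial.homogeneousSubmodule ι ℂ) (pointIdeal x)

/-- The stalk at `x` of the ideal sheaf of `X`: the degree-zero fractions `f / g`, `g(x) ≠ 0`,
lying in the extension of the homogeneous ideal of `X`. -/
noncomputable def stalkIdeal {ι : Type} (X : Set (CProj ι)) (x : CProj ι) :
    Ideal (AmbientLocalRing x) :=
  Ideal.comap (algebraMap (AmbientLocalRing x) (Localization.AtPrime (pointIdeal x)))
    (Ideal.map (algebraMap (MvPolynomial ι ℂ) (Localization.AtPrime (pointIdeal x)))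
      (homogIdeal X))

/-- `x` is a singular point of `X`: the local ring `𝒪_{X,x}` is not regular. -/
def IsSingularPoint {ι : Type} (X : Set (CProj ι)) (x : CProj ι) : Prop :=
  x ∈ X ∧ ¬ IsRegularLocalRing (AmbientLocalRing x ⧸ stalkIdeal X x)

/-- `A` is the zero locus of a family of homogeneous polynomials of degree at most `q`. -/
def CutOutInDegreeLE {ι : Type} (q : ℕ) (A : Set (CProj ι)) : Prop :=
  ∃ S : Set (MvPolynomial ι ℂ), (∀ F ∈ S, ∃ k ≤ q, F.IsHomogeneous k) ∧ A = projZeroLocus S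

/-- The set of points (reduced structure) of the subscheme of the linear span `⟨T⟩` defined by the
homogeneous pieces of degree at most `q` of the ideal of `T`.  (Every form on `⟨T⟩` is the
restriction of a form of the same degree on the ambient space.) -/
def lowDegreeLocus {ι : Type} (q : ℕ) (T : Set (CProj ι)) : Set (CProj ι) :=
  {z ∈ linSpan T | ∀ k ≤ q, ∀ F : MvPolynomial ι ℂ, F.IsHomogeneous k →
    (∀ t ∈ T, VanishesAt F t) → VanishesAt F z}

/-- `C` is an irreducible component of `Z`. -/
def IsIrredComponentOf {ι : Type} (C Z : Set (CProj ι)) : Prop :=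
  Maximal (fun s : Set (CProj ι) => IsIrreducible s ∧ s ⊆ Z) C

/-- `T` is a union of irreducible components of `Z`.  If `T` is closed and irreducible, this says
that `T` is an irreducible component of `Z`. -/
def IsUnionOfComponents {ι : Type} (T Z : Set (CProj ι)) : Prop :=
  ∃ 𝒞 : Set (Set (CProj ι)), (∀ C ∈ 𝒞, IsIrredComponentOf C Z) ∧ T = ⋃₀ 𝒞

/-! Write `r = s + 2` and choose distinct points `y_1, ..., y_s` of `X` other than `x`. The theorem
rests on one equivalence, `PointConfiguration.mk_mem_tangentStar_iff`: `z` lies in the tangent star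
`T` exactly when the tensor `x ^ (d - 1) z + ∑ y_j ^ d` (first term scaled by `d`) lies in the cone
over `σ_r(v_d(X))`. Thus `T` is an affine-linear slice of the secant variety. For `X = ℙⁿ` the
tangent star is everything, so the tensors with `z ∈ ⟨T⟩` always lie in `σ_r(v_d(ℙⁿ)) ∩ ⟨v_d(X)⟩`;
equality in 1 would force `T = ⟨T⟩`. Equations of degree at most `q` for the secant variety pull
back to polynomials of degree at most `q` for `T`, so that `Z_q = T`. If `X` is finite, there may be
too few points `y_j`, but then `T = {x}` and both claims are immediate.

Closures are handled by places (`exists_place`): a point of a closure is the reduction, along a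
valuation ring `O` of a field `K`, of a generalized point over `K`. If `z ∈ T`, two vectors `a, b`
over `O` reduce to `x` and the line joining them reduces to one through `z`; the difference quotient
of `a ^ d` and `b ^ d` then reduces to `x ^ (d - 1) z` modulo `x ^ d`.

Conversely, let `∑ c_i u_i ^ d` over `K` reduce to the tensor, with primitive integral `u_i`.
Contracting with a product of `d` linear forms, chosen so that each `u_i` is killed by one of them,
gives zero over `O`, hence a relation between `x`, `z` and the `y_j` (`contract_specialization`).
Suitable products show that each `y_j` is the reduction of some `u_i`, that the two remaining `u_i`
reduce to `x`, and that every form killing both reduces to one vanishing at `z`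
(`ContractionRelations.exists_pair`). Hence the line through those two reduces to a line through `x`
and `z`. The longest product needed has `2 s + 3 = 2 r - 1` factors, which is where the bound on `d`
enters. -/

/-! ### Monomials, their first-order variation, and contraction with products of linear forms -/

/-- The value of the monomial `m` at `v`, over any commutative ring. -/
def symMon {R ι : Type*} [CommRing R] {d : ℕ} (v : ι → R) (m : Sym ι d) : R :=
  ((m : Multiset ι).map v).prod

/-- The linear coefficient in `t` of the monomial `m` at `x + t z`. -/
noncomputable def tangentMon {R ι : Type*} [CommRing R] {d : ℕ} (x z : ι → R) (m : Sym ι d) : R :=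
  (symMon (fun i => Polynomial.C (x i) + Polynomial.X * Polynomial.C (z i)) m).coeff 1

section Monomials

variable {R S ι : Type*} [CommRing R] [CommRing S] {d : ℕ}

theorem map_symMon (f : R →+* S) (v : ι → R) (m : Sym ι d) :
    f (symMon v m) = symMon (fun i => f (v i)) m := by
  simp [symMon, map_multiset_prod, Multiset.map_map]

theorem symMon_smul (c : R) (v : ι → R) (m : Sym ι d) :
    symMon (fun i => c * v i) m = c ^ d * symMon v m := by
  simp [symMon, Multiset.prod_map_mul]

theorem map_tangentMon (f : R →+* S) (x z : ι → R) (m : Sym ι d) :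
    f (tangentMon x z m) = tangentMon (fun i => f (x i)) (fun i => f (z i)) m := by
  have := map_symMon (Polynomial.mapRingHom f)
    (fun i => Polynomial.C (x i) + Polynomial.X * Polynomial.C (z i)) m
  simp only [Polynomial.coe_mapRingHom, Polynomial.map_add, Polynomial.map_mul, Polynomial.map_C,
    Polynomial.map_X] at this
  rw [tangentMon, tangentMon, ← this, Polynomial.coeff_map]

theorem symMon_line_coeff_zero (x z : ι → R) (m : Sym ι d) :
    (symMon (fun i => Polynomial.C (x i) + Polynomial.X * Polynomial.C (z i)) m).coeff 0 =
      symMon x m := by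
  have := map_symMon (Polynomial.evalRingHom (0 : R))
    (fun i => Polynomial.C (x i) + Polynomial.X * Polynomial.C (z i)) m
  simpa [Polynomial.coeff_zero_eq_eval_zero] using this

/-- Taylor expansion to second order. It is applied with `t` in the maximal ideal of a valuation
ring, so that the remainder disappears on reduction. -/
theorem symMon_add_mul (a w : ι → R) (t : R) (m : Sym ι d) :
    ∃ e, symMon (fun i => a i + t * w i) m =
      symMon a m + t * (tangentMon a w m + t * e) := by
  set Q := symMon (fun i => Polynomial.C (a i) + Polynomial.X * Polynomial.C (w i)) m with hQ
  have h := map_symMon (Polynomial.evalRingHom t)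
    (fun i => Polynomial.C (a i) + Polynomial.X * Polynomial.C (w i)) m
  simp only [Polynomial.coe_evalRingHom, Polynomial.eval_add, Polynomial.eval_mul,
    Polynomial.eval_C, Polynomial.eval_X] at h
  refine ⟨Q.divX.divX.eval t, ?_⟩
  have h0 : Q.coeff 0 = symMon a m := symMon_line_coeff_zero a w m
  have h1 : Q.divX.coeff 0 = tangentMon a w m := by rw [Polynomial.coeff_divX]; rfl
  rw [← h, ← hQ]
  conv_lhs => rw [← Polynomial.divX_mul_X_add Q, ← Polynomial.divX_mul_X_add Q.divX]
  simp only [Polynomial.eval_add, Polynomial.eval_mul, Polynomial.eval_C, Polynomial.eval_X, h0, h1]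
  ring

theorem tangentMon_add_mul (x z z' : ι → R) (c : R) (m : Sym ι d) :
    tangentMon x (fun i => z i + c * z' i) m = tangentMon x z m + c * tangentMon x z' m := by
  obtain ⟨s, hs⟩ := m
  simp only [tangentMon, symMon, Sym.coe_mk]
  clear hs
  induction s using Multiset.induction with
  | empty => simp [Polynomial.coeff_one]
  | cons a s ih =>
    have h0 : ∀ z : ι → R, ((s.map fun i => Polynomial.C (x i) +
        Polynomial.X * Polynomial.C (z i)).prod).coeff 0 = (s.map x).prod := fun z =>
      symMon_line_coeff_zero (d := s.card) x z ⟨s, rfl⟩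
    simp only [Multiset.map_cons, Multiset.prod_cons, add_mul, Polynomial.coeff_add,
      Polynomial.coeff_C_mul, mul_assoc, Polynomial.coeff_X_mul, h0] at ih ⊢
    rw [ih]
    ring

/-- Euler's identity; the factor `d` appears because `tangentMon x z` is the full derivative `d x ^
(d - 1) z`. -/
theorem tangentMon_self (x : ι → R) (m : Sym ι d) :
    tangentMon x x m = d * symMon x m := by
  obtain ⟨s, rfl⟩ := m
  simp only [tangentMon, symMon, Sym.coe_mk]
  induction s using Multiset.induction with
  | empty => simp [Polynomial.coeff_one]
  | cons a s ih =>
    have h0 : ((s.map fun i => Polynomial.C (x i) +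
        Polynomial.X * Polynomial.C (x i)).prod).coeff 0 = (s.map x).prod :=
      symMon_line_coeff_zero (d := s.card) x x ⟨s, rfl⟩
    simp only [Multiset.map_cons, Multiset.prod_cons, add_mul, Polynomial.coeff_add,
      Polynomial.coeff_C_mul, mul_assoc, Polynomial.coeff_X_mul, h0, Multiset.card_cons] at ih ⊢
    rw [ih]
    push_cast
    ring

variable [Fintype ι]

/-- The contraction of a symmetric tensor of degree `d`, given by its coordinates, with the
product of `d` linear forms. -/
noncomputable def contract (l : Fin d → ι → R) (w : Sym ι d → R) : R :=
  ∑ g : Fin d → ι, (∏ j, l j (g j)) * w ⟨Finset.univ.val.map g, by simp⟩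

/-- Because `contract` sums over ordered tuples of indices rather than multisets, expanding the
product produces it without multinomial coefficients. -/
theorem contract_symMon (l : Fin d → ι → R) (v : ι → R) :
    contract l (symMon v) = ∏ j, (l j ⬝ᵥ v) := by
  classical
  simp only [dotProduct, Finset.prod_univ_sum, Fintype.piFinset_univ, contract]
  refine Finset.sum_congr rfl fun g _ => ?_
  rw [Finset.prod_mul_distrib]
  congr 1
  simp [symMon, Finset.prod, Function.comp_def]

/-- Apply `contract_symMon` over `R[t]` to the vector `x + t z` and compare coefficients of `t`. -/
theorem contract_tangentMon (l : Fin d → ι → R) (x z : ι → R) :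
    contract l (tangentMon x z) =
      (∏ j, (Polynomial.C (l j ⬝ᵥ x) + Polynomial.X * Polynomial.C (l j ⬝ᵥ z))).coeff 1 := by
  have h := contract_symMon (fun j i => Polynomial.C (l j i))
    (fun i => Polynomial.C (x i) + Polynomial.X * Polynomial.C (z i))
  have h2 : ∀ j, ((fun i => Polynomial.C (l j i)) ⬝ᵥ
      fun i => Polynomial.C (x i) + Polynomial.X * Polynomial.C (z i)) =
      Polynomial.C (l j ⬝ᵥ x) + Polynomial.X * Polynomial.C (l j ⬝ᵥ z) := by
    intro j
    simp only [dotProduct, map_sum, map_mul, Finset.mul_sum, ← Finset.sum_add_distrib]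
    exact Finset.sum_congr rfl fun i _ => by ring
  simp only [h2] at h
  rw [← h, contract, contract, Polynomial.finsetSum_coeff]
  refine Finset.sum_congr rfl fun g _ => ?_
  rw [← map_prod, Polynomial.coeff_C_mul]
  rfl

theorem map_contract (f : R →+* S) (l : Fin d → ι → R) (w : Sym ι d → R) :
    f (contract l w) = contract (fun j i => f (l j i)) (fun m => f (w m)) := by
  simp [contract, map_sum, map_mul, map_prod]

theorem contract_add (l : Fin d → ι → R) (w w' : Sym ι d → R) :
    contract l (fun m => w m + w' m) = contract l w + contract l w' := by
  simp [contract, mul_add, Finset.sum_add_distrib]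

theorem contract_sum_mul {I : Type*} [Fintype I] (l : Fin d → ι → R) (c : I → R)
    (w : I → Sym ι d → R) :
    contract l (fun m => ∑ i, c i * w i m) = ∑ i, c i * contract l (w i) := by
  simp only [contract, Finset.mul_sum]
  rw [Finset.sum_comm]
  exact Finset.sum_congr rfl fun i _ => Finset.sum_congr rfl fun g _ => by ring

theorem map_dotProduct' (f : R →+* S) (v w : ι → R) :
    f (v ⬝ᵥ w) = (fun i => f (v i)) ⬝ᵥ fun i => f (w i) := by
  simp [dotProduct]

/-- If a sum of `d`-th powers of vectors over `O` specializes to the tensor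
`x ^ (d - 1) z + ∑ y j ^ d` and `d` linear forms over `O` kill those vectors, then the product of
the specialized forms kills the specialized tensor. -/
theorem contract_specialization {O K k : Type*} [CommRing O] [CommRing K] [CommRing k]
    (i : O →+* K) (hi : Function.Injective i) (ρ : O →+* k)
    {I J : Type*} [Fintype I] [Fintype J] (c : I → K) (u : I → ι → O) (P : Sym ι d → O)
    (hP : ∀ m, i (P m) = ∑ a, c a * symMon (fun l => i (u a l)) m)
    (x z : ι → k) (y : J → ι → k)
    (hρ : ∀ m, ρ (P m) = tangentMon x z m + ∑ j, symMon (y j) m)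
    (M : Multiset (ι → O)) (hM : M.card = d) (hkill : ∀ a, ∃ l ∈ M, l ⬝ᵥ u a = 0) :
    (M.map fun l : ι → O => Polynomial.C ((fun s => ρ (l s)) ⬝ᵥ x) +
        Polynomial.X * Polynomial.C ((fun s => ρ (l s)) ⬝ᵥ z)).prod.coeff 1 +
      ∑ j, (M.map fun l : ι → O => (fun s => ρ (l s)) ⬝ᵥ y j).prod = 0 := by
  obtain ⟨L, rfl⟩ : ∃ L : List (ι → O), M = L := ⟨M.toList, by simp⟩
  rw [Multiset.coe_card] at hM
  subst hM
  -- The vanishing is checked in `K`, where `P` is a sum of powers and each summand meets a form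
  -- that kills it; it descends to `O` by injectivity and is then reduced by `ρ`.
  have h0 : contract (fun j : Fin L.length => L[j]) P = 0 := by
    apply hi
    rw [map_zero, map_contract, funext hP, contract_sum_mul]
    refine Finset.sum_eq_zero fun a _ => ?_
    obtain ⟨l, hl, hla⟩ := hkill a
    obtain ⟨n, hn, rfl⟩ := List.getElem_of_mem (Multiset.mem_coe.mp hl)
    rw [contract_symMon, Finset.prod_eq_zero (Finset.mem_univ (⟨n, hn⟩ : Fin L.length)), mul_zero]
    rw [← map_dotProduct']
    exact (congrArg i hla).trans (map_zero i)
  have h1 := congrArg ρ h0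
  have h2 : (fun m => ρ (P m)) = fun m => tangentMon x z m + ∑ j, 1 * symMon (y j) m :=
    funext fun m => by simp [hρ]
  rw [map_zero, map_contract, h2, contract_add, contract_sum_mul] at h1
  erw [contract_tangentMon] at h1
  simp only [contract_symMon, one_mul] at h1
  simp only [Multiset.map_coe, Multiset.prod_coe]
  refine Eq.trans ?_ h1
  congr 1
  · rw [← Fin.prod_univ_fun_getElem]
    rfl
  · refine Finset.sum_congr rfl fun j _ => ?_
    rw [← Fin.prod_univ_fun_getElem]
    rfl

end Monomials

/-! ### Specializations along a place -/

/-- If every polynomial that vanishes on the image of `f : Y → ℂ^σ` vanishes at `p`, then `p` is the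
specialization, along a valuation ring containing `ℂ`, of a generalized point of `Y`. -/
theorem exists_place {Y σ : Type} (f : σ → Y → ℂ) (p : σ → ℂ)
    (h : ∀ g : MvPolynomial σ ℂ, (∀ y, MvPolynomial.eval (fun s => f s y) g = 0) →
      MvPolynomial.eval p g = 0) :
    ∃ (K : Type) (_ : Field K) (_ : Algebra ℂ K) (φ : (Y → ℂ) →ₐ[ℂ] K) (O : ValuationSubring K),
      Function.Surjective φ ∧ (∀ c : ℂ, algebraMap ℂ K c ∈ O) ∧
      ∀ s, φ (f s) - algebraMap ℂ K (p s) ∈ O.nonunits := by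
  classical
  let ev : MvPolynomial σ ℂ →ₐ[ℂ] (Y → ℂ) := MvPolynomial.aeval f
  have hev : ∀ g y, ev g y = MvPolynomial.eval (fun s => f s y) g := by
    intro g y
    have : (Pi.evalAlgHom ℂ (fun _ : Y => ℂ) y).comp ev = MvPolynomial.aeval (fun s => f s y) := by
      apply MvPolynomial.algHom_ext
      intro s
      simp [ev]
    have := DFunLike.congr_fun this g
    simpa [MvPolynomial.aeval_eq_eval] using this
  let evp : MvPolynomial σ ℂ →ₐ[ℂ] ℂ := MvPolynomial.aeval p
  let m : Ideal (MvPolynomial σ ℂ) := RingHom.ker evp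
  have hm : m.IsPrime := RingHom.ker_isPrime _
  -- By `h`, a polynomial not vanishing at `p` is not identically zero on `Y`, so the image of the
  -- complement of `m` is a multiplicative set avoiding `0`.
  obtain ⟨Q, hQ, -, hQd⟩ := Ideal.exists_le_prime_disjoint (⊥ : Ideal (Y → ℂ))
    (m.primeCompl.map (ev : MvPolynomial σ ℂ →* (Y → ℂ))) (by
      rw [Set.disjoint_left]
      rintro a ha ⟨g, hg, rfl⟩
      apply hg
      have h1 := h g fun y => by rw [← hev]; exact congrFun (by simpa using ha) y
      simpa [m, evp, RingHom.mem_ker, MvPolynomial.aeval_eq_eval] using h1)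
  -- A product of fields is von Neumann regular: `a * (a * a⁻¹ - 1) = 0`, so its primes are maximal.
  have hmax : Q.IsMaximal := by
    rw [Ideal.Quotient.maximal_ideal_iff_isField_quotient]
    refine ⟨⟨0, 1, zero_ne_one⟩, mul_comm, ?_⟩
    intro a ha
    obtain ⟨a, rfl⟩ := Ideal.Quotient.mk_surjective a
    refine ⟨Ideal.Quotient.mk Q a⁻¹, ?_⟩
    rw [← map_mul, ← map_one (Ideal.Quotient.mk Q), Ideal.Quotient.eq]
    have h0 : a * (a * a⁻¹ - 1) ∈ Q := by
      convert Q.zero_mem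
      funext y
      by_cases hy : a y = 0 <;> simp [hy]
    exact (hQ.mem_or_mem h0).resolve_left fun h => ha (Ideal.Quotient.eq_zero_iff_mem.mpr h)
  let K := (Y → ℂ) ⧸ Q
  let _ : Field K := Ideal.Quotient.field Q
  let φ : (Y → ℂ) →ₐ[ℂ] K := Ideal.Quotient.mkₐ ℂ Q
  let ψ : MvPolynomial σ ℂ →ₐ[ℂ] K := φ.comp ev
  have hψ : ∀ g, ψ g = 0 → g ∈ m := by
    intro g hg
    by_contra hgm
    exact Set.disjoint_left.mp hQd (Ideal.Quotient.eq_zero_iff_mem.mp hg) ⟨g, hgm, rfl⟩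
  -- The kernel of `ψ` lies in `m`, so `m` generates a proper ideal of the image `A`; some valuation
  -- ring contains `A` and has that ideal among its nonunits.
  let A : Subring K := (ψ : MvPolynomial σ ℂ →+* K).range
  let I : Ideal A := m.map (ψ : MvPolynomial σ ℂ →+* K).rangeRestrict
  have hI : I ≠ ⊤ := by
    intro hI
    rw [Ideal.eq_top_iff_one, Ideal.mem_map_iff_of_surjective
      (ψ : MvPolynomial σ ℂ →+* K).rangeRestrict (RingHom.rangeRestrict_surjective _)] at hI
    obtain ⟨g, hg, hg1⟩ := hI
    have h1 : ψ (1 - g) = 0 := by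
      have : ψ g = 1 := congrArg Subtype.val hg1
      rw [map_sub, map_one, this, sub_self]
    exact hm.ne_top ((Ideal.eq_top_iff_one _).mpr (by simpa using m.add_mem (hψ _ h1) hg))
  obtain ⟨O, hAO, hO⟩ := Ideal.image_subset_nonunits_valuationSubring I hI
  refine ⟨K, inferInstance, inferInstance, φ, O, Ideal.Quotient.mk_surjective, ?_, ?_⟩
  · intro c
    exact hAO ⟨MvPolynomial.C c, ψ.commutes c⟩
  · intro s
    have hs : MvPolynomial.X s - MvPolynomial.C (p s) ∈ m := by
      simp [m, evp, RingHom.mem_ker]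
    refine hO ⟨_, Ideal.mem_map_of_mem _ hs, ?_⟩
    change ψ (MvPolynomial.X s - MvPolynomial.C (p s)) = _
    rw [map_sub]
    congr 1
    · simp [ψ, ev]
    · exact ψ.commutes _

/-- `exists_place` in terms of the residue map of the valuation ring. -/
theorem exists_place_residue {Y σ : Type} (f : σ → Y → ℂ) (p : σ → ℂ)
    (h : ∀ g : MvPolynomial σ ℂ, (∀ y, MvPolynomial.eval (fun s => f s y) g = 0) →
      MvPolynomial.eval p g = 0) :
    ∃ (K : Type) (_ : Field K) (_ : Algebra ℂ K) (φ : (Y → ℂ) →ₐ[ℂ] K) (O : ValuationSubring K)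
      (τ : ℂ →+* O),
      Function.Surjective φ ∧ (∀ c : ℂ, (τ c : K) = algebraMap ℂ K c) ∧
      ∀ s, ∃ a : O, (a : K) = φ (f s) ∧
        IsLocalRing.residue O a = IsLocalRing.residue O (τ (p s)) := by
  obtain ⟨K, _, _, φ, O, hφ, hC, hO⟩ := exists_place f p h
  refine ⟨K, _, _, φ, O, (algebraMap ℂ K).codRestrict O.toSubring hC, hφ, fun c => rfl, fun s => ?_⟩
  have b := O.nonunits_subset (hO s)
  have hbm : (⟨_, b⟩ : O) ∈ IsLocalRing.maximalIdeal O := O.coe_mem_nonunits_iff.mp (hO s)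
  refine ⟨⟨φ (f s) - algebraMap ℂ K (p s), b⟩ + ((algebraMap ℂ K).codRestrict O.toSubring hC) (p s),
    ?_, ?_⟩
  · exact sub_add_cancel _ _
  · rw [map_add, (IsLocalRing.residue_eq_zero_iff _).mpr hbm, zero_add]

/-! ### Proportional vectors -/

/-- Two vectors have a nonzero `2 × 2` minor. -/
def NonProportional {R ι : Type*} [CommRing R] (a b : ι → R) : Prop :=
  ∃ i l, a i * b l ≠ a l * b i

section Proportional

variable {R k ι : Type*} [CommRing R] [Field k]

theorem NonProportional.symm {a b : ι → R} (h : NonProportional a b) : NonProportional b a := by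
  obtain ⟨i, l, h⟩ := h
  exact ⟨l, i, fun h' => h (by rw [mul_comm, h', mul_comm])⟩

theorem not_nonProportional_iff {a b : ι → R} :
    ¬ NonProportional a b ↔ ∀ i l, a i * b l = a l * b i := by
  simp [NonProportional]

theorem not_nonProportional_trans {a b c : ι → k} (ha : a ≠ 0) (hb : ¬ NonProportional a b)
    (hc : ¬ NonProportional a c) : ¬ NonProportional b c := by
  rw [not_nonProportional_iff] at *
  obtain ⟨s, hs⟩ := Function.ne_iff.mp ha
  intro i l
  apply mul_left_cancel₀ (mul_ne_zero hs hs)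
  linear_combination (a s * c l) * hb s i + (a i * b s) * hc s l - (a s * c i) * hb s l -
    (a l * b s) * hc s i

theorem nonProportional_iff_mk_ne {a b : ι → k} (ha : a ≠ 0) (hb : b ≠ 0) :
    NonProportional a b ↔ Projectivization.mk k a ha ≠ Projectivization.mk k b hb := by
  rw [← not_iff_not, not_nonProportional_iff, not_not, Projectivization.mk_eq_mk_iff']
  constructor
  · intro h
    obtain ⟨s, hs⟩ := Function.ne_iff.mp hb
    refine ⟨a s / b s, funext fun i => ?_⟩
    have := h s i
    simp only [Pi.smul_apply, smul_eq_mul, Pi.zero_apply] at hs ⊢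
    field_simp
    linear_combination this
  · rintro ⟨c, rfl⟩ i l
    simp only [Pi.smul_apply, smul_eq_mul]
    ring

theorem dotProduct_eq_zero_of_not_nonProportional [Fintype ι] {a b l : ι → k} (ha : a ≠ 0)
    (hab : ¬ NonProportional a b) (hl : l ⬝ᵥ a = 0) : l ⬝ᵥ b = 0 := by
  rw [not_nonProportional_iff] at hab
  obtain ⟨s, hs⟩ := Function.ne_iff.mp ha
  apply (mul_eq_zero.mp _).resolve_left hs
  have h : l ⬝ᵥ (a s • b) = l ⬝ᵥ (b s • a) := by
    congr 1
    funext i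
    simp [hab s i, mul_comm]
  rw [dotProduct_smul, dotProduct_smul, hl] at h
  simpa using h

variable [DecidableEq ι]

/-- The linear form whose value at `v` is the minor `a i * v l - a l * v i`. -/
def minorForm (a : ι → R) (i l : ι) : ι → R :=
  Pi.single l (a i) - Pi.single i (a l)

theorem minorForm_dotProduct [Fintype ι] (a v : ι → R) (i l : ι) :
    minorForm a i l ⬝ᵥ v = a i * v l - a l * v i := by
  simp [minorForm, sub_dotProduct]

theorem minorForm_self [Fintype ι] (a : ι → R) (i l : ι) : minorForm a i l ⬝ᵥ a = 0 := by
  rw [minorForm_dotProduct]; ring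

theorem map_minorForm {S : Type*} [CommRing S] (f : R →+* S) (a : ι → R) (i l : ι) :
    (fun s => f (minorForm a i l s)) = minorForm (fun s => f (a s)) i l := by
  funext s
  simp only [minorForm, Pi.sub_apply, map_sub, Pi.single_apply]
  split_ifs <;> simp

/-- If the reduction of `a` is not proportional to `v`, then some form over `R` kills `a` and does
not kill `v` after reduction. -/
theorem NonProportional.exists_form [Fintype ι] {S : Type*} [CommRing S] (f : R →+* S) {a : ι → R} {v : ι → S}
    (h : NonProportional (fun s => f (a s)) v) :
    ∃ l : ι → R, l ⬝ᵥ a = 0 ∧ (fun s => f (l s)) ⬝ᵥ v ≠ 0 := by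
  obtain ⟨i, j, h⟩ := h
  refine ⟨minorForm a i j, minorForm_self a i j, ?_⟩
  rw [map_minorForm, minorForm_dotProduct]
  exact sub_ne_zero.mpr h

theorem exists_form_ne_zero [Fintype ι] {S : Type*} [CommRing S] (f : R →+* S) {v : ι → S} (hv : v ≠ 0) :
    ∃ l : ι → R, (fun s => f (l s)) ⬝ᵥ v ≠ 0 := by
  obtain ⟨i, hi⟩ := Function.ne_iff.mp hv
  refine ⟨Pi.single i 1, ?_⟩
  have : (fun s => f ((Pi.single i 1 : ι → R) s)) = Pi.single i 1 := by
    funext s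
    simp only [Pi.single_apply]
    split_ifs <;> simp
  rw [this]
  simpa using hi

/-- A nonzero vector over the field of fractions of a valuation ring is proportional to an integral
vector with a coordinate `1`. -/
theorem exists_primitive {K ι : Type*} [Field K] (O : ValuationSubring K) [Fintype ι]
    {u : ι → K} (hu : u ≠ 0) :
    ∃ (c : K) (a : ι → O) (i : ι), c ≠ 0 ∧ (∀ l, (a l : K) = c * u l) ∧ a i = 1 := by
  obtain ⟨s, hs⟩ := Function.ne_iff.mp hu
  -- Divide by the coordinate of largest valuation.
  obtain ⟨i, -, hi⟩ := Finset.exists_max_image Finset.univ (fun l => O.valuation (u l))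
    ⟨s, Finset.mem_univ s⟩
  have hui : u i ≠ 0 := by
    intro h
    have := hi s (Finset.mem_univ s)
    rw [h, map_zero, le_zero_iff, map_eq_zero] at this
    exact hs this
  have hmem : ∀ l, (u i)⁻¹ * u l ∈ O := by
    intro l
    rw [← O.valuation_le_one_iff, map_mul, map_inv₀, mul_comm]
    have h0 : O.valuation (u i) ≠ 0 := (map_ne_zero _).mpr hui
    exact (mul_inv_le_iff₀ (zero_lt_iff.mpr h0)).mpr (by simpa using hi l (Finset.mem_univ l))
  exact ⟨(u i)⁻¹, fun l => ⟨_, hmem l⟩, i, inv_ne_zero hui, fun l => rfl,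
    Subtype.ext (inv_mul_cancel₀ hui)⟩

end Proportional

/-! ### Secant spaces that specialize to `x ^ (d - 1) z + ∑ y j ^ d` -/

/-- The vectors `x, y j` over `k` and `a i` over `O` satisfy the relations obtained by contracting
with products of `d` linear forms over `O` which kill all the `a i`. -/
def ContractionRelations {O k ι I J : Type*} [CommRing O] [CommRing k] [Fintype ι] [Fintype J]
    (d : ℕ) (ρ : O →+* k) (a : I → ι → O) (x z : ι → k) (y : J → ι → k) : Prop :=
  ∀ M : Multiset (ι → O), M.card = d → (∀ i, ∃ l ∈ M, l ⬝ᵥ a i = 0) →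
    (M.map fun l : ι → O => Polynomial.C ((fun s => ρ (l s)) ⬝ᵥ x) +
        Polynomial.X * Polynomial.C ((fun s => ρ (l s)) ⬝ᵥ z)).prod.coeff 1 +
      ∑ j, (M.map fun l : ι → O => (fun s => ρ (l s)) ⬝ᵥ y j).prod = 0

namespace ContractionRelations

variable {O k ι : Type*} [CommRing O] [Field k] [Fintype ι] {ρ : O →+* k} {d s : ℕ}
  {x z : ι → k} {y : Fin s → ι → k} {a : Fin (s + 2) → ι → O}

/-- Every `y j` is the reduction of some `a i`. -/
theorem exists_reduction [DecidableEq ι] (H : ContractionRelations d ρ a x z y)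
    (hρ : Function.Surjective ρ) (hd : 2 * s + 3 ≤ d)
    (hxy : ∀ j, NonProportional x (y j)) (hy : ∀ i j, i ≠ j → NonProportional (y i) (y j))
    (hy0 : ∀ j, y j ≠ 0) (j : Fin s) :
    ∃ i, ¬ NonProportional (fun l => ρ (a i l)) (y j) := by
  by_contra! hcon
  choose f hf hfy using fun i => (hcon i).exists_form ρ
  choose τ hτ using hρ
  have hlift : ∀ v : ι → k, NonProportional v (y j) →
      ∃ l : ι → O, (fun s => ρ (l s)) ⬝ᵥ v = 0 ∧ (fun s => ρ (l s)) ⬝ᵥ y j ≠ 0 := by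
    intro v hv
    obtain ⟨l, h1, h2⟩ := NonProportional.exists_form (RingHom.id k) (a := v) hv
    exact ⟨fun s => τ (l s), by simpa [hτ] using h1, by simpa [hτ] using h2⟩
  obtain ⟨g, hg, hgy⟩ := hlift x (hxy j)
  choose! h hh hhy using fun i (hi : i ≠ j) => hlift (y i) (hy i j hi)
  obtain ⟨e, he⟩ := exists_form_ne_zero ρ (hy0 j)
  have hs : 0 < s := j.pos
  -- If no `a i` reduces to `y j`, each is killed by a form `f i` not vanishing at `y j`. Two copies
  -- of `g` kill `x` to second order, the `h i` kill the other `y i`, and copies of `e` fill up to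
  -- degree `d`; the count before filling is `2 + (s + 2) + (s - 1) = 2 s + 3`. Only the nonzero
  -- value at `y j` survives.
  have hrel := H ({g} + {g} + Finset.univ.val.map f + (Finset.univ.erase j).val.map h +
    Multiset.replicate (d - (2 * s + 3)) e) (by
      simp only [Multiset.card_add, Multiset.card_singleton, Multiset.card_map,
        Multiset.card_replicate, Finset.card_val, Finset.card_univ, Fintype.card_fin,
        Finset.card_erase_of_mem (Finset.mem_univ j)]
      omega) (fun i => ⟨f i, Multiset.mem_add.mpr (.inl (Multiset.mem_add.mpr (.inl (Multiset.mem_add.mpr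
        (.inr (Multiset.mem_map_of_mem _ (Finset.mem_univ_val i))))))), hf i⟩)
  simp only [Multiset.map_add, Multiset.prod_add, Multiset.map_singleton, Multiset.prod_singleton,
    hg, map_zero, zero_add] at hrel
  rw [Finset.sum_eq_single j] at hrel
  · have h1 : ∀ P Q R : Polynomial k, ∀ c : k, (Polynomial.X * Polynomial.C c *
        (Polynomial.X * Polynomial.C c) * P * Q * R).coeff 1 = 0 := by
      intro P Q R c
      have : Polynomial.X * Polynomial.C c * (Polynomial.X * Polynomial.C c) * P * Q * R =
          Polynomial.X * (Polynomial.X * (Polynomial.C c * Polynomial.C c * P * Q * R)) := by ring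
      rw [this, Polynomial.coeff_X_mul, Polynomial.coeff_X_mul_zero]
    rw [h1, zero_add] at hrel
    revert hrel
    refine mul_ne_zero (mul_ne_zero (mul_ne_zero (mul_ne_zero hgy hgy) ?_) ?_) ?_
    · simp [hfy]
    · rw [ne_eq, Multiset.prod_eq_zero_iff]
      simp only [Multiset.map_map, Multiset.mem_map, Function.comp, Finset.mem_val,
        Finset.mem_erase, not_exists, not_and]
      exact fun i hi => hhy i hi.1
    · simp [he]
  · intro i _ hi
    have : ((Finset.univ.erase j).val.map h |>.map
        fun l : ι → O => (fun s => ρ (l s)) ⬝ᵥ y i).prod = 0 := by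
      rw [Multiset.prod_eq_zero_iff, Multiset.map_map, Multiset.mem_map]
      exact ⟨i, Finset.mem_erase.mpr ⟨hi, Finset.mem_univ i⟩, hh i hi⟩
    rw [this, mul_zero, zero_mul]
  · simp

/-- Once the `y j` are matched with reductions of `a (f j)`, a product of at most three forms killing
the remaining two `a i`, exactly one of which vanishes at `x`, vanishes to second order. -/
theorem dotProduct_eq_zero [DecidableEq ι] (H : ContractionRelations d ρ a x z y)
    (hd : s + 3 ≤ d) (hx0 : x ≠ 0) (hxy : ∀ j, NonProportional x (y j))
    (ha : ∀ i, (fun l => ρ (a i l)) ≠ 0)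
    (f : Fin s → Fin (s + 2)) (hf : ∀ j, ¬ NonProportional (fun l => ρ (a (f j) l)) (y j))
    (l : ι → O) (N : Multiset (ι → O)) (hN : N.card ≤ 2)
    (hkill : ∀ i, (∃ j, f j = i) ∨ ∃ l' ∈ l ::ₘ N, l' ⬝ᵥ a i = 0)
    (hl : (fun t => ρ (l t)) ⬝ᵥ x = 0) (hNx : ∀ l' ∈ N, (fun t => ρ (l' t)) ⬝ᵥ x ≠ 0) :
    (fun t => ρ (l t)) ⬝ᵥ z = 0 := by
  have hax : ∀ j, NonProportional (fun l => ρ (a (f j) l)) x := by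
    intro j
    by_contra hcon
    exact not_nonProportional_trans (ha _) hcon (hf j) (hxy j)
  choose g hg hgx using fun j => (hax j).exists_form ρ
  have hgy : ∀ j, (fun t => ρ (g j t)) ⬝ᵥ y j = 0 := fun j =>
    dotProduct_eq_zero_of_not_nonProportional (ha _) (hf j) (by
      rw [← map_dotProduct', hg, map_zero])
  obtain ⟨e, he⟩ := exists_form_ne_zero ρ hx0
  -- The form `g j` disposes of both `a (f j)` and `y j` without vanishing at `x`. Since `l` alone
  -- vanishes at `x`, the coefficient of `t` is the value of `l` at `z` times nonzero values at `x`.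
  have hrel := H (l ::ₘ (N + Finset.univ.val.map g +
    Multiset.replicate (d - (1 + N.card + s)) e)) (by
      simp only [Multiset.card_cons, Multiset.card_add, Multiset.card_map,
        Multiset.card_replicate, Finset.card_val, Finset.card_univ, Fintype.card_fin]
      omega) (fun i => by
        rcases hkill i with ⟨j, rfl⟩ | ⟨l', hl', h⟩
        · exact ⟨g j, by simp, hg j⟩
        · refine ⟨l', ?_, h⟩
          rw [Multiset.mem_cons] at hl'
          rcases hl' with rfl | hl' <;> simp [*])
  rw [Finset.sum_eq_zero, add_zero, Multiset.map_cons, Multiset.prod_cons, hl, map_zero, zero_add,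
    mul_assoc, Polynomial.coeff_X_mul, Polynomial.coeff_C_mul] at hrel
  · refine (mul_eq_zero.mp hrel).resolve_right ?_
    rw [Polynomial.coeff_zero_eq_eval_zero, ← Polynomial.coe_evalRingHom, map_multiset_prod,
      Multiset.map_map, Multiset.prod_eq_zero_iff]
    simp only [Multiset.mem_map, Multiset.mem_add, not_exists, not_and]
    intro l' hl'
    simp only [Function.comp, Polynomial.coe_evalRingHom, Polynomial.eval_add, Polynomial.eval_C,
      Polynomial.eval_mul, Polynomial.eval_X, zero_mul, add_zero]
    rcases hl' with (hl' | ⟨j, -, rfl⟩) | hl'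
    · exact hNx l' hl'
    · exact hgx j
    · rw [Multiset.eq_of_mem_replicate hl']
      exact he
  · intro j _
    rw [Multiset.prod_eq_zero_iff, Multiset.mem_map]
    exact ⟨g j, by simp, hgy j⟩

/-- Two of the `a i` reduce to `x`, and every form killing both of them reduces to a form that
vanishes at `z`. -/
theorem exists_pair [DecidableEq ι] (H : ContractionRelations d ρ a x z y)
    (hρ : Function.Surjective ρ) (hd : 2 * s + 3 ≤ d) (hx0 : x ≠ 0)
    (hxz : NonProportional x z)
    (hxy : ∀ j, NonProportional x (y j)) (hy : ∀ i j, i ≠ j → NonProportional (y i) (y j))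
    (hy0 : ∀ j, y j ≠ 0) (ha : ∀ i, (fun l => ρ (a i l)) ≠ 0) :
    ∃ p q, ¬ NonProportional (fun l => ρ (a p l)) x ∧ ¬ NonProportional (fun l => ρ (a q l)) x ∧
      ∀ l : ι → O, l ⬝ᵥ a p = 0 → l ⬝ᵥ a q = 0 → (fun t => ρ (l t)) ⬝ᵥ z = 0 := by
  choose f hf using H.exists_reduction hρ hd hxy hy hy0
  have hfinj : Function.Injective f := by
    intro i j hij
    by_contra hne
    have h1 := hf i
    rw [hij] at h1
    exact not_nonProportional_trans (ha _) h1 (hf j) (hy i j hne)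
  -- Distinct `y j` need distinct `a i`, so exactly two of the `s + 2` indices remain.
  obtain ⟨p, q, hpq, hset⟩ : ∃ p q, p ≠ q ∧ (Finset.univ.image f)ᶜ = {p, q} := by
    rw [← Finset.card_eq_two, Finset.card_compl, Finset.card_image_of_injective _ hfinj]
    simp
  have hcov : ∀ i, (∃ j, f j = i) ∨ i = p ∨ i = q := by
    intro i
    by_cases hi : i ∈ Finset.univ.image f
    · left; simpa using hi
    · right; simpa [hset] using Finset.mem_compl.mpr hi
  have key := H.dotProduct_eq_zero (by omega) hx0 hxy ha f hf
  have hred : ∀ p q, (∀ i, (∃ j, f j = i) ∨ i = p ∨ i = q) →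
      ¬ NonProportional (fun l => ρ (a p l)) x := by
    intro p q hcov hp
    obtain ⟨g, hg, hgx⟩ := hp.exists_form ρ
    -- If neither of the two reduces to `x`, they are killed by forms not vanishing at `x`, and `l`
    -- may be any form with zero at `x` and not at `z`. If only `a q` reduces to `x`, then a form
    -- killing `a q` but not `z` serves as `l`. Either way `z` should be a zero of `l`.
    by_cases hq : NonProportional (fun l => ρ (a q l)) x
    · obtain ⟨h, hh, hhx⟩ := hq.exists_form ρ
      obtain ⟨l, hl, hlz⟩ := NonProportional.exists_form (RingHom.id k) (a := x) hxz
      choose τ hτ using hρ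
      have := key (fun t => τ (l t)) {g, h} (by simp) (fun i => by
        rcases hcov i with hi | rfl | rfl
        · exact .inl hi
        · exact .inr ⟨g, by simp, hg⟩
        · exact .inr ⟨h, by simp, hh⟩) (by simpa [hτ] using hl) (by simp [hgx, hhx])
      exact hlz (by simpa [hτ] using this)
    · have hqz : NonProportional (fun l => ρ (a q l)) z := by
        by_contra hcon
        exact not_nonProportional_trans (ha q) hq hcon hxz
      obtain ⟨l, hl, hlz⟩ := hqz.exists_form ρ
      refine hlz (key l {g} (by simp) (fun i => ?_) ?_ (by simp [hgx]))
      · rcases hcov i with hi | rfl | rfl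
        · exact .inl hi
        · exact .inr ⟨g, by simp, hg⟩
        · exact .inr ⟨l, by simp, hl⟩
      · exact dotProduct_eq_zero_of_not_nonProportional (ha q) hq
          (by rw [← map_dotProduct', hl, map_zero])
  refine ⟨p, q, hred p q hcov, hred q p fun i => (hcov i).imp_right Or.symm, fun l hp hq => ?_⟩
  refine key l 0 (by simp) (fun i => ?_) ?_ (by simp)
  · rcases hcov i with hi | rfl | rfl
    · exact .inl hi
    · exact .inr ⟨l, by simp, hp⟩
    · exact .inr ⟨l, by simp, hq⟩
  · exact dotProduct_eq_zero_of_not_nonProportional (ha p) (hred p q hcov)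
      (by rw [← map_dotProduct', hp, map_zero])

end ContractionRelations

/-- A nonzero reduction proportional to a vector with coordinate `1` can be rescaled to it. -/
theorem exists_rescale {K ι : Type*} [Field K] (O : ValuationSubring K)
    {x : ι → IsLocalRing.ResidueField O} {i : ι} (hx : x i = 1) {a : ι → O}
    (ha : (fun l => IsLocalRing.residue O (a l)) ≠ 0)
    (hax : ¬ NonProportional (fun l => IsLocalRing.residue O (a l)) x) :
    ∃ c : O, c ≠ 0 ∧ c * a i = 1 ∧ ∀ l, IsLocalRing.residue O (c * a l) = x l := by
  rw [not_nonProportional_iff] at hax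
  have h1 : ∀ l, IsLocalRing.residue O (a l) = IsLocalRing.residue O (a i) * x l := fun l => by
    have := hax l i
    rw [hx, mul_one] at this
    exact this
  have h2 : IsLocalRing.residue O (a i) ≠ 0 := by
    intro h
    exact ha (funext fun l => by rw [h1, h, zero_mul]; rfl)
  obtain ⟨c, hc⟩ := isUnit_iff_exists_inv'.mp ((IsLocalRing.residue_ne_zero_iff_isUnit _).mp h2)
  refine ⟨c, left_ne_zero_of_mul_eq_one hc, hc, fun l => ?_⟩
  rw [map_mul, h1, ← mul_assoc, ← map_mul, hc, map_one, one_mul]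

/-- If a combination of `s + 2` powers of vectors over `K` specializes to
`x ^ (d - 1) z + ∑ y j ^ d`, then two of the vectors specialize to `x` and the line that joins them
specializes to a line through `z`. -/
theorem exists_line_of_specialization {K ι : Type*} [Field K] (O : ValuationSubring K) [Fintype ι]
    [DecidableEq ι] {d s : ℕ} (hd : 2 * s + 3 ≤ d)
    {x z : ι → IsLocalRing.ResidueField O} {y : Fin s → ι → IsLocalRing.ResidueField O}
    {k₀ : ι} (hx : x k₀ = 1) (hxz : NonProportional x z)
    (hxy : ∀ j, NonProportional x (y j)) (hy : ∀ i j, i ≠ j → NonProportional (y i) (y j))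
    (hy0 : ∀ j, y j ≠ 0) (c : Fin (s + 2) → K) (u : Fin (s + 2) → ι → K) (hu : ∀ i, u i ≠ 0)
    (P : Sym ι d → O) (hP : ∀ m, (P m : K) = ∑ i, c i * symMon (u i) m)
    (hPr : ∀ m, IsLocalRing.residue O (P m) = tangentMon x z m + ∑ j, symMon (y j) m) :
    ∃ (p q : Fin (s + 2)) (α β α' β' : K) (a b w : ι → O),
      (∀ l, (a l : K) = α * u p l) ∧ (∀ l, (b l : K) = β * u q l) ∧
      (∀ l, (w l : K) = α' * (a l : K) + β' * (b l : K)) ∧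
      (∀ l, IsLocalRing.residue O (a l) = x l) ∧ (∀ l, IsLocalRing.residue O (b l) = x l) ∧
      (∀ l, IsLocalRing.residue O (w l) = z l) := by
  choose e v i₁ he hv hvi using fun i => exists_primitive O (hu i)
  have hx0 : x ≠ 0 := fun h => by simp [h] at hx
  have hv0 : ∀ i, (fun l => IsLocalRing.residue O (v i l)) ≠ 0 := fun i h => by
    have := congrFun h (i₁ i)
    simp [hvi] at this
  have H : ContractionRelations d (IsLocalRing.residue O) v x z y := by
    refine contract_specialization O.subtype Subtype.val_injective (IsLocalRing.residue O)
      (fun i => c i * (e i ^ d)⁻¹) v P (fun m => ?_) x z y hPr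
    rw [ValuationSubring.subtype_apply, hP]
    refine Finset.sum_congr rfl fun i _ => ?_
    have : (fun l => O.subtype (v i l)) = fun l => e i * u i l := funext (hv i)
    rw [this, symMon_smul]
    have := pow_ne_zero d (he i)
    field_simp
  obtain ⟨p, q, hp, hq, hpq⟩ := H.exists_pair IsLocalRing.residue_surjective hd hx0 hxz hxy hy hy0 hv0
  obtain ⟨α, hα0, hα, hαx⟩ := exists_rescale O hx (hv0 p) hp
  obtain ⟨β, hβ0, hβ, hβx⟩ := exists_rescale O hx (hv0 q) hq
  set a : ι → O := fun l => α * v p l with ha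
  set b : ι → O := fun l => β * v q l with hb
  have har : ∀ l, IsLocalRing.residue O (a l) = x l := hαx
  have hab : ∀ l : ι → O, l ⬝ᵥ a = 0 → l ⬝ᵥ b = 0 →
      (fun t => IsLocalRing.residue O (l t)) ⬝ᵥ z = 0 := by
    intro l h1 h2
    apply hpq
    · have : l ⬝ᵥ (α • v p) = 0 := h1
      rw [dotProduct_smul, smul_eq_mul] at this
      exact (mul_eq_zero.mp this).resolve_left hα0
    · have : l ⬝ᵥ (β • v q) = 0 := h2
      rw [dotProduct_smul, smul_eq_mul] at this
      exact (mul_eq_zero.mp this).resolve_left hβ0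
  -- If `a = b`, the minors of `a` would kill both, making `z` proportional to `x`.
  have hne : (fun l => (b l : K) - (a l : K)) ≠ 0 := by
    intro h
    have hba : b = a := funext fun l => Subtype.ext (sub_eq_zero.mp (congrFun h l))
    obtain ⟨i, j, hij⟩ := hxz
    have h1 := hab (minorForm a i j) (minorForm_self a i j) (hba ▸ minorForm_self a i j)
    rw [map_minorForm, minorForm_dotProduct, hαx, hαx] at h1
    exact hij (sub_eq_zero.mp h1)
  obtain ⟨γ, w, i, hγ, hw, hwi⟩ := exists_primitive O hne
  have hz : ∀ l, z l = x l * z k₀ + IsLocalRing.residue O (w l) * (z i - x i * z k₀) := by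
    intro l
    -- On the plane spanned by `a` and `w`, the coefficients of a vector `t` are `t k₀` and `t i - a
    -- i * t k₀`, provided `a k₀ = 1`, `w k₀ = 0` and `w i = 1`. The form `N` measures the failure
    -- of this in coordinate `l`; it kills `a` and `b`, so its reduction kills `z` and expresses `z`
    -- through `x` and the reduction of `w`.
    let N : ι → O := Pi.single l 1 - Pi.single k₀ (a l) -
      w l • (Pi.single i 1 - Pi.single k₀ (a i))
    have hN : ∀ t : ι → O, N ⬝ᵥ t = t l - a l * t k₀ - w l * (t i - a i * t k₀) := by
      intro t
      simp [N, sub_dotProduct, smul_dotProduct]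
    have hNa : N ⬝ᵥ a = 0 := by
      rw [hN]
      simp only [ha, hα]
      ring
    have hNb : N ⬝ᵥ b = 0 := by
      rw [hN]
      have hbk : b k₀ = 1 := hβ
      rw [hbk]
      apply Subtype.val_injective
      apply mul_left_cancel₀ hγ
      have h1 := hw l
      have h2 := hw i
      rw [hwi] at h2
      push_cast at h2 ⊢
      linear_combination -h1 + (w l : K) * h2
    have h1 := hab N hNa hNb
    have hNr : (fun t => IsLocalRing.residue O (N t)) =
        Pi.single l 1 - Pi.single k₀ (x l) -
          IsLocalRing.residue O (w l) • (Pi.single i 1 - Pi.single k₀ (x i)) := by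
      funext t
      simp only [N, Pi.sub_apply, Pi.smul_apply, Pi.single_apply, smul_eq_mul, map_sub, map_mul]
      split_ifs <;> simp [har]
    rw [hNr] at h1
    simp only [sub_dotProduct, smul_dotProduct, single_dotProduct, smul_eq_mul] at h1
    linear_combination h1
  obtain ⟨ζ, hζ⟩ := IsLocalRing.residue_surjective (z k₀)
  obtain ⟨η, hη⟩ := IsLocalRing.residue_surjective (z i - x i * z k₀)
  refine ⟨p, q, α * e p, β * e q, ζ - γ * η, γ * η, a, b, fun l => a l * ζ + w l * η,
    fun l => ?_, fun l => ?_, fun l => ?_, hαx, hβx, fun l => ?_⟩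
  · rw [mul_assoc, ← hv]; rfl
  · rw [mul_assoc, ← hv]; rfl
  · push_cast
    rw [hw]
    ring
  · rw [map_add, map_mul _ (a l), map_mul _ (w l), hζ, hη, hz l, har]

/-! ### Zariski closures in terms of vectors -/

/-- `v` is a nonzero vector representing a point of `X`. -/
def Represents {ι : Type} (X : Set (CProj ι)) (v : ι → ℂ) : Prop :=
  ∃ hv : v ≠ 0, Projectivization.mk ℂ v hv ∈ X

theorem represents_rep {ι : Type} {X : Set (CProj ι)} {p : CProj ι} (hp : p ∈ X) :
    Represents X p.rep :=
  ⟨p.rep_nonzero, by rwa [Projectivization.mk_rep]⟩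

theorem Represents.smul {ι : Type} {X : Set (CProj ι)} {v : ι → ℂ} (h : Represents X v) {t : ℂ}
    (ht : t ≠ 0) : Represents X (t • v) := by
  obtain ⟨hv, h⟩ := h
  refine ⟨smul_ne_zero ht hv, ?_⟩
  convert h using 1
  rw [Projectivization.mk_eq_mk_iff']
  exact ⟨t, rfl⟩

theorem Represents.exists_smul_rep {ι : Type} {X : Set (CProj ι)} {v : ι → ℂ}
    (h : Represents X v) : ∃ p ∈ X, ∃ t : ℂ, t ≠ 0 ∧ v = t • p.rep := by
  obtain ⟨hv, h⟩ := h
  obtain ⟨a, ha⟩ := Projectivization.exists_smul_eq_mk_rep ℂ v hv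
  refine ⟨_, h, ((a⁻¹ : ℂˣ) : ℂ), a⁻¹.ne_zero, ?_⟩
  rw [← ha, Units.smul_def, smul_smul]
  simp

theorem eval_smul_of_isHomogeneous {ι : Type} {F : MvPolynomial ι ℂ} {k : ℕ}
    (hF : F.IsHomogeneous k) (t : ℂ) (v : ι → ℂ) :
    MvPolynomial.eval (t • v) F = t ^ k * MvPolynomial.eval v F := by
  rw [MvPolynomial.eval_eq, MvPolynomial.eval_eq, Finset.mul_sum]
  refine Finset.sum_congr rfl fun m hm => ?_
  have hdeg : ∑ i ∈ m.support, m i = k := by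
    have := hF (MvPolynomial.mem_support_iff.mp hm)
    simpa [Finsupp.weight_apply, Finsupp.sum] using this
  simp only [Pi.smul_apply, smul_eq_mul, mul_pow, Finset.prod_mul_distrib,
    Finset.prod_pow_eq_pow_sum, hdeg]
  ring

theorem polynomial_eq_zero_of_eval_ne_zero {Q : Polynomial ℂ} (h : ∀ t : ℂ, t ≠ 0 → Q.eval t = 0) :
    Q = 0 := by
  apply Polynomial.eq_zero_of_infinite_isRoot
  exact (Set.infinite_of_finite_compl (s := {t : ℂ | t ≠ 0}) (by simp [Set.compl_def])).mono
    fun t ht => h t ht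

/-- The values of the components at `v` are the coefficients of `g (t v)` as a polynomial in `t`,
which has infinitely many zeros. -/
theorem eval_homogeneousComponent_eq_zero {ι : Type} {g : MvPolynomial ι ℂ} {v : ι → ℂ}
    (h : ∀ t : ℂ, t ≠ 0 → MvPolynomial.eval (t • v) g = 0) (k : ℕ) :
    MvPolynomial.eval v (MvPolynomial.homogeneousComponent k g) = 0 := by
  let Q : Polynomial ℂ := ∑ i ∈ Finset.range (g.totalDegree + 1),
    Polynomial.monomial i (MvPolynomial.eval v (MvPolynomial.homogeneousComponent i g))
  have hQ : Q = 0 := by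
    refine polynomial_eq_zero_of_eval_ne_zero fun t ht => ?_
    rw [← h t ht]
    conv_rhs => rw [← MvPolynomial.sum_homogeneousComponent g, map_sum]
    rw [Polynomial.eval_finsetSum]
    refine Finset.sum_congr rfl fun i _ => ?_
    rw [eval_smul_of_isHomogeneous (MvPolynomial.homogeneousComponent_isHomogeneous i g),
      Polynomial.eval_monomial, mul_comm]
  by_cases hk : k ∈ Finset.range (g.totalDegree + 1)
  · have := congrArg (fun Q => Polynomial.coeff Q k) hQ
    simpa [Q, Polynomial.finsetSum_coeff, Polynomial.coeff_monomial, Finset.mem_range.mp hk]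
      using this
  · rw [MvPolynomial.homogeneousComponent_eq_zero, map_zero]
    simpa using hk

theorem mem_closure_mk_iff {ι : Type} {A : Set (CProj ι)} {v : ι → ℂ} (hv : v ≠ 0) :
    Projectivization.mk ℂ v hv ∈ closure A ↔ ∀ (k : ℕ) (F : MvPolynomial ι ℂ), F.IsHomogeneous k →
      (∀ w, Represents A w → MvPolynomial.eval w F = 0) → MvPolynomial.eval v F = 0 := by
  constructor
  · intro h k F hF hFA
    have hc : IsClosed (projZeroLocus {F}) :=
      (zariski_isClosed_iff _).mpr ⟨{F}, by rintro _ rfl; exact ⟨k, hF⟩, rfl⟩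
    have := closure_minimal (s := A) (fun p hp => by
      rintro _ rfl
      exact hFA _ (represents_rep hp)) hc h F rfl
    rwa [vanishesAt_mk hF] at this
  · intro h
    obtain ⟨S, hS, hAS⟩ := (zariski_isClosed_iff (closure A)).mp isClosed_closure
    rw [hAS]
    intro F hF
    obtain ⟨k, hk⟩ := hS F hF
    rw [vanishesAt_mk hk]
    refine h k F hk ?_
    rintro w ⟨hw, hwA⟩
    rw [← vanishesAt_mk hk w hw]
    have := subset_closure hwA
    rw [hAS] at this
    exact this F hF

theorem mk_mem_linSpan_iff {ι : Type} {A : Set (CProj ι)} {v : ι → ℂ} (hv : v ≠ 0) :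
    Projectivization.mk ℂ v hv ∈ linSpan A ↔ v ∈ Submodule.span ℂ {w | Represents A w} := by
  constructor
  · intro h
    have h1 : Projectivization.Subspace.span A ≤
        (Submodule.span ℂ {w | Represents A w}).projectivization := by
      rw [Projectivization.Subspace.span_le_subspace_iff]
      intro p hp
      have : p.rep ∈ Submodule.span ℂ {w | Represents A w} :=
        Submodule.subset_span (represents_rep hp)
      rw [SetLike.mem_coe, ← p.mk_rep, Submodule.mk_mem_projectivization_iff]
      exact this
    exact (Submodule.mk_mem_projectivization_iff _ hv).mp (h1 h)
  · intro h
    suffices H : ∀ v ∈ Submodule.span ℂ {w | Represents A w}, ∀ hv : v ≠ 0,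
        Projectivization.mk ℂ v hv ∈ Projectivization.Subspace.span A from H v h hv
    intro v hv
    induction hv using Submodule.span_induction with
    | mem v hv => exact fun _ => Projectivization.Subspace.subset_span _ hv.2
    | zero => exact fun h => absurd rfl h
    | add v w _ _ ihv ihw =>
      intro hvw
      by_cases hv : v = 0
      · subst hv
        simpa using ihw (by simpa using hvw)
      by_cases hw : w = 0
      · subst hw
        simpa using ihv hv
      exact Projectivization.Subspace.mem_add _ v w hv hw hvw (ihv hv) (ihw hw)
    | smul t v _ ih =>
      intro htv
      have hv : v ≠ 0 := right_ne_zero_of_smul htv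
      convert ih hv using 1
      rw [Projectivization.mk_eq_mk_iff']
      exact ⟨t, rfl⟩

theorem Represents.mk_mem_linSpan {ι : Type} {A : Set (CProj ι)} {v : ι → ℂ}
    (hv : Represents (linSpan A) v) : v ∈ Submodule.span ℂ {w | Represents A w} :=
  (mk_mem_linSpan_iff hv.1).mp hv.2

/-! ### Secant varieties of Veronese images -/

/-- The cone over the union of the spans of `r` points of `v_d(X)`. -/
def secantCone {ι : Type} (r d : ℕ) (X : Set (CProj ι)) : Set (Sym ι d → ℂ) :=
  {w | ∃ (c : Fin r → ℂ) (y : Fin r → ι → ℂ), (∀ i, Represents X (y i)) ∧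
    w = fun m => ∑ i, c i * symMon (y i) m}

/-- `w` lies in the Zariski closure of the cone over the secant spaces. -/
def InSecantClosure {ι : Type} (r d : ℕ) (X : Set (CProj ι)) (w : Sym ι d → ℂ) : Prop :=
  ∀ g : MvPolynomial (Sym ι d) ℂ, (∀ w' ∈ secantCone r d X, MvPolynomial.eval w' g = 0) →
    MvPolynomial.eval w g = 0

theorem smul_mem_secantCone {ι : Type} {r d : ℕ} {X : Set (CProj ι)} {w : Sym ι d → ℂ}
    (hw : w ∈ secantCone r d X) (t : ℂ) : t • w ∈ secantCone r d X := by
  obtain ⟨c, y, hy, rfl⟩ := hw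
  refine ⟨fun i => t * c i, y, hy, funext fun m => ?_⟩
  simp [Finset.mul_sum, mul_assoc]

theorem symMon_mem_secantCone {ι : Type} {r d : ℕ} (hr : 0 < r) {X : Set (CProj ι)} {x : ι → ℂ}
    (hx : Represents X x) : (symMon x : Sym ι d → ℂ) ∈ secantCone r d X := by
  refine ⟨Pi.single ⟨0, hr⟩ 1, fun _ => x, fun _ => hx, ?_⟩
  funext m
  simp [← Finset.sum_mul]

theorem represents_veronese_image {ι : Type} {d : ℕ} {X : Set (CProj ι)} {y : ι → ℂ}
    (hy : Represents X y) : Represents (veronese d '' X) (symMon y : Sym ι d → ℂ) :=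
  ⟨veroneseVec_ne_zero d hy.1, _, hy.2, veronese_mk d y hy.1⟩

theorem mem_secantCone_of_represents {ι : Type} {r d : ℕ} {X : Set (CProj ι)} {w : Sym ι d → ℂ}
    (hw : Represents {p | ∃ y : Fin r → CProj (Sym ι d), (∀ i, y i ∈ veronese d '' X) ∧
      p ∈ linSpan (Set.range y)} w) : w ∈ secantCone r d X := by
  obtain ⟨hw0, y, hy, hw⟩ := hw
  choose x hx hxy using hy
  rw [mk_mem_linSpan_iff] at hw
  have hle : Submodule.span ℂ {w | Represents (Set.range y) w} ≤
      Submodule.span ℂ (Set.range fun i => (symMon (x i).rep : Sym ι d → ℂ)) := by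
    rw [Submodule.span_le]
    rintro v ⟨hv, i, hi⟩
    rw [← hxy] at hi
    obtain ⟨t, ht⟩ := (Projectivization.mk_eq_mk_iff' _ _ _ _ _).mp hi.symm
    rw [← ht]
    exact Submodule.smul_mem _ _ (Submodule.subset_span ⟨i, rfl⟩)
  obtain ⟨c, hc⟩ := (Submodule.mem_span_range_iff_exists_fun ℂ).mp (hle hw)
  refine ⟨c, fun i => (x i).rep, fun i => represents_rep (hx i), ?_⟩
  rw [← hc]
  funext m
  simp

theorem represents_of_mem_secantCone {ι : Type} {r d : ℕ} {X : Set (CProj ι)} {w : Sym ι d → ℂ}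
    (hw : w ∈ secantCone r d X) (hw0 : w ≠ 0) :
    Represents {p | ∃ y : Fin r → CProj (Sym ι d), (∀ i, y i ∈ veronese d '' X) ∧
      p ∈ linSpan (Set.range y)} w := by
  obtain ⟨c, y, hy, rfl⟩ := hw
  have hv := fun i => represents_veronese_image (d := d) (hy i)
  refine ⟨hw0, fun i => Projectivization.mk ℂ _ (hv i).1, fun i => (hv i).2, ?_⟩
  rw [mk_mem_linSpan_iff]
  have : (fun m => ∑ i, c i * symMon (y i) m) = ∑ i, c i • (symMon (y i) : Sym ι d → ℂ) := by
    funext m; simp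
  rw [this]
  exact Submodule.sum_mem _ fun i _ => Submodule.smul_mem _ _
    (Submodule.subset_span ⟨(hv i).1, i, rfl⟩)

/-- The cone is stable under scaling, so arbitrary polynomials and homogeneous ones define the same
closure. The affine form is the one that `exists_place_residue` accepts. -/
theorem inSecantClosure_iff {ι : Type} {r d : ℕ} (hr : 0 < r) {X : Set (CProj ι)}
    (hX : X.Nonempty) (w : Sym ι d → ℂ) :
    InSecantClosure r d X w ↔
      ∀ hw : w ≠ 0, Projectivization.mk ℂ w hw ∈ secantVariety r (veronese d '' X) := by
  obtain ⟨x, hx⟩ := hX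
  have hmem : (symMon x.rep : Sym ι d → ℂ) ∈ secantCone r d X :=
    symMon_mem_secantCone hr (represents_rep hx)
  have hne : (symMon x.rep : Sym ι d → ℂ) ≠ 0 := veroneseVec_ne_zero d x.rep_nonzero
  constructor
  · intro h hw
    refine (mem_closure_mk_iff hw).mpr fun k F hF hFA => h F ?_
    intro w' hw'
    by_cases h0 : w' = 0
    · subst h0
      have := eval_smul_of_isHomogeneous hF 0 (symMon x.rep : Sym ι d → ℂ)
      rw [zero_smul, hFA _ (represents_of_mem_secantCone hmem hne), mul_zero] at this
      exact this
    · exact hFA _ (represents_of_mem_secantCone hw' h0)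
  · intro h g hg
    have hcomp : ∀ k, ∀ w' ∈ secantCone r d X,
        MvPolynomial.eval w' (MvPolynomial.homogeneousComponent k g) = 0 := fun k w' hw' =>
      eval_homogeneousComponent_eq_zero (fun t _ => hg _ (smul_mem_secantCone hw' t)) k
    rw [← MvPolynomial.sum_homogeneousComponent g, map_sum]
    refine Finset.sum_eq_zero fun k _ => ?_
    have hk := MvPolynomial.homogeneousComponent_isHomogeneous k g
    by_cases hw : w = 0
    · have := eval_smul_of_isHomogeneous hk 0 w
      have h2 := eval_smul_of_isHomogeneous hk 0 (symMon x.rep : Sym ι d → ℂ)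
      rw [hcomp k _ hmem, mul_zero, zero_smul] at h2
      rw [hw, h2]
    · exact (mem_closure_mk_iff hw).mp (h hw) k _ hk fun w' hw' =>
        hcomp k w' (mem_secantCone_of_represents hw')

/-- A linear functional vanishing on `v_d(X)` is a polynomial vanishing on the secant cone. -/
theorem InSecantClosure.mem_span {ι : Type} {r d : ℕ} [Finite ι] {X : Set (CProj ι)}
    {w : Sym ι d → ℂ} (h : InSecantClosure r d X w) :
    w ∈ Submodule.span ℂ {v | Represents (veronese d '' X) v} := by
  classical
  have := Fintype.ofFinite ι
  by_contra hw
  obtain ⟨f, hf, hle⟩ := Submodule.exists_le_ker_of_notMem hw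
  let g : MvPolynomial (Sym ι d) ℂ :=
    ∑ m, MvPolynomial.C (f (Pi.single m 1)) * MvPolynomial.X m
  have hg : ∀ v, MvPolynomial.eval v g = f v := by
    intro v
    rw [LinearMap.pi_apply_eq_sum_univ f v]
    simp only [g, map_sum, map_mul, MvPolynomial.eval_C, MvPolynomial.eval_X, smul_eq_mul]
    refine Finset.sum_congr rfl fun m _ => ?_
    rw [mul_comm]
    congr 2
    funext l
    simp [Pi.single_apply, eq_comm]
  apply hf
  rw [← hg]
  refine h g ?_
  rintro _ ⟨c, y, hy, rfl⟩
  rw [hg]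
  apply hle
  have : (fun m => ∑ i, c i * symMon (y i) m) = ∑ i, c i • (symMon (y i) : Sym ι d → ℂ) := by
    funext m; simp
  rw [this]
  exact Submodule.sum_mem _ fun i _ => Submodule.smul_mem _ _
    (Submodule.subset_span (represents_veronese_image (hy i)))

/-! ### The tangent star in terms of vectors -/

theorem eval_mul_of_isWeightedHomogeneous {κ ι : Type} [Fintype κ] [DecidableEq κ]
    {G : MvPolynomial (κ × ι) ℂ} {m : κ → ℕ}
    (hG : G.IsWeightedHomogeneous (fun ji : κ × ι => (Pi.single ji.1 1 : κ → ℕ)) m)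
    (t : κ → ℂ) (v : κ × ι → ℂ) :
    MvPolynomial.eval (fun s => t s.1 * v s) G = (∏ j, t j ^ m j) * MvPolynomial.eval v G := by
  rw [MvPolynomial.eval_eq, MvPolynomial.eval_eq, Finset.mul_sum]
  refine Finset.sum_congr rfl fun e he => ?_
  have hdeg : ∑ s ∈ e.support, e s • (Pi.single s.1 1 : κ → ℕ) = m := by
    have := hG (MvPolynomial.mem_support_iff.mp he)
    simpa [Finsupp.weight_apply, Finsupp.sum] using this
  have hprod : ∏ s ∈ e.support, t s.1 ^ e s = ∏ j, t j ^ m j := by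
    rw [← hdeg]
    simp only [Finset.sum_apply, Pi.smul_apply, smul_eq_mul, ← Finset.prod_pow_eq_pow_sum]
    rw [Finset.prod_comm]
    refine Finset.prod_congr rfl fun s _ => ?_
    rw [Finset.prod_eq_single s.1] <;> simp +contextual
  simp only [mul_pow, Finset.prod_mul_distrib, hprod]
  ring

theorem eval_weightedHomogeneousComponent_eq_zero {κ ι : Type} [Fintype κ] [DecidableEq κ]
    {g : MvPolynomial (κ × ι) ℂ} {v : κ × ι → ℂ}
    (h : ∀ t : κ → ℂ, (∀ j, t j ≠ 0) → MvPolynomial.eval (fun s => t s.1 * v s) g = 0)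
    (m : κ → ℕ) :
    MvPolynomial.eval v (MvPolynomial.weightedHomogeneousComponent
      (fun ji : κ × ι => (Pi.single ji.1 1 : κ → ℕ)) m g) = 0 := by
  set W := fun m => MvPolynomial.weightedHomogeneousComponent
    (fun ji : κ × ι => (Pi.single ji.1 1 : κ → ℕ)) m g with hW
  have hfin : (Function.support W).Finite := MvPolynomial.weightedHomogeneousComponent_finsupp g
  have hsum : g = ∑ m ∈ hfin.toFinset, W m := by
    rw [← finsum_eq_sum W hfin]
    exact (MvPolynomial.sum_weightedHomogeneousComponent _ g).symm
  let Q : MvPolynomial κ ℂ := ∑ m ∈ hfin.toFinset,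
    MvPolynomial.monomial (Finsupp.equivFunOnFinite.symm m) (MvPolynomial.eval v (W m))
  have hQ : Q = 0 := by
    -- The hypothesis covers only nonzero scalars; the extra factor takes care of the coordinate
    -- hyperplanes.
    have h1 : (∏ j, MvPolynomial.X j) * Q = 0 := by
      apply MvPolynomial.funext
      intro t
      rw [map_mul, map_zero, map_prod]
      simp only [MvPolynomial.eval_X]
      by_cases ht : ∀ j, t j ≠ 0
      · refine mul_eq_zero_of_right _ ?_
        rw [← h t ht]
        conv_rhs => rw [hsum, map_sum]
        rw [map_sum]
        refine Finset.sum_congr rfl fun m _ => ?_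
        rw [eval_mul_of_isWeightedHomogeneous
          (MvPolynomial.weightedHomogeneousComponent_isWeightedHomogeneous m g),
          MvPolynomial.eval_monomial, mul_comm]
        congr 1
        exact Finsupp.prod_fintype _ _ fun _ => pow_zero _
      · push Not at ht
        obtain ⟨j, hj⟩ := ht
        exact mul_eq_zero_of_left (Finset.prod_eq_zero (Finset.mem_univ j) hj) _
    exact (mul_eq_zero.mp h1).resolve_left
      (Finset.prod_ne_zero_iff.mpr fun j _ => MvPolynomial.X_ne_zero j)
  by_cases hm : m ∈ hfin.toFinset
  · have h1 := congrArg (MvPolynomial.coeff (Finsupp.equivFunOnFinite.symm m)) hQ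
    simpa only [Q, MvPolynomial.coeff_sum, MvPolynomial.coeff_monomial,
      EmbeddingLike.apply_eq_iff_eq, Finset.sum_ite_eq', hm, if_true, MvPolynomial.coeff_zero]
      using h1
  · have : W m = 0 := by simpa using hm
    change MvPolynomial.eval v (W m) = 0
    rw [this, map_zero]

/-- The coordinates of a triple of vectors. -/
def triple {R ι : Type} (a b c : ι → R) : Fin 3 × ι → R := fun s => ![a, b, c] s.1 s.2

theorem triple_smul {ι : Type} (t : Fin 3 → ℂ) (a b c : ι → ℂ) :
    (fun s => t s.1 * triple a b c s) = triple (t 0 • a) (t 1 • b) (t 2 • c) := by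
  funext ⟨j, i⟩
  fin_cases j <;> rfl

theorem rep_eq_triple {ι : Type} (a : Fin 3 → CProj ι) :
    (fun s : Fin 3 × ι => (a s.1).rep s.2) = triple (a 0).rep (a 1).rep (a 2).rep := by
  funext ⟨j, i⟩
  fin_cases j <;> rfl

/-- The triples of vectors representing `a, b ∈ X` and a point of the line `⟨a, b⟩`. -/
def incidenceCone {ι : Type} (X : Set (CProj ι)) : Set (Fin 3 × ι → ℂ) :=
  {v | ∃ a b c, v = triple a b c ∧ Represents X a ∧ Represents X b ∧ c ≠ 0 ∧
    ∃ α β : ℂ, c = α • a + β • b}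

theorem mul_mem_incidenceCone {ι : Type} {X : Set (CProj ι)} {v : Fin 3 × ι → ℂ}
    (hv : v ∈ incidenceCone X) {t : Fin 3 → ℂ} (ht : ∀ j, t j ≠ 0) :
    (fun s => t s.1 * v s) ∈ incidenceCone X := by
  obtain ⟨a, b, c, rfl, ha, hb, hc, α, β, rfl⟩ := hv
  refine ⟨_, _, _, triple_smul t _ _ _, ha.smul (ht 0), hb.smul (ht 1), smul_ne_zero (ht 2) hc,
    t 2 * α * (t 0)⁻¹, t 2 * β * (t 1)⁻¹, ?_⟩
  rw [smul_smul, smul_smul, mul_assoc, inv_mul_cancel₀ (ht 0), mul_assoc _ _ (t 1),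
    inv_mul_cancel₀ (ht 1), smul_add, smul_smul, smul_smul, mul_one, mul_one]

theorem rep_mem_incidenceCone {ι : Type} {X : Set (CProj ι)} {a : Fin 3 → CProj ι}
    (ha : a 0 ∈ X ∧ a 1 ∈ X ∧ a 2 ∈ linSpan {a 0, a 1}) :
    triple (a 0).rep (a 1).rep (a 2).rep ∈ incidenceCone X := by
  obtain ⟨h0, h1, h2⟩ := ha
  refine ⟨_, _, _, rfl, represents_rep h0, represents_rep h1, (a 2).rep_nonzero, ?_⟩
  have h3 : (a 2).rep ∈ Submodule.span ℂ {(a 0).rep, (a 1).rep} := by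
    refine Submodule.span_le.mpr ?_ (represents_rep h2).mk_mem_linSpan
    intro w hw
    obtain ⟨p, hp, t, -, rfl⟩ := Represents.exists_smul_rep hw
    refine Submodule.smul_mem _ _ (Submodule.subset_span ?_)
    rcases hp with rfl | rfl <;> simp
  obtain ⟨α, β, h⟩ := Submodule.mem_span_pair.mp h3
  exact ⟨α, β, h.symm⟩

/-- The incidence cone is stable under scaling the three vectors independently, so multihomogeneous
polynomials may be replaced by arbitrary ones. -/
theorem mk_mem_tangentStar_iff {ι : Type} {X : Set (CProj ι)} {x z : ι → ℂ} (hx : x ≠ 0)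
    (hz : z ≠ 0) :
    Projectivization.mk ℂ z hz ∈ tangentStar X (Projectivization.mk ℂ x hx) ↔
      ∀ g : MvPolynomial (Fin 3 × ι) ℂ, (∀ v ∈ incidenceCone X, MvPolynomial.eval v g = 0) →
        MvPolynomial.eval (triple x x z) g = 0 := by
  obtain ⟨a, ha⟩ := Projectivization.exists_smul_eq_mk_rep ℂ x hx
  obtain ⟨b, hb⟩ := Projectivization.exists_smul_eq_mk_rep ℂ z hz
  rw [Units.smul_def] at ha hb
  set t : Fin 3 → ℂ := ![a, a, b] with ht
  have ht0 : ∀ j, t j ≠ 0 := by intro j; fin_cases j <;> simp [t]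
  have hrep : (fun s : Fin 3 × ι => ((![Projectivization.mk ℂ x hx, Projectivization.mk ℂ x hx,
      Projectivization.mk ℂ z hz] : Fin 3 → CProj ι) s.1).rep s.2) =
      fun s => t s.1 * triple x x z s := by
    rw [rep_eq_triple, triple_smul]
    simp only [t, Matrix.cons_val_zero, Matrix.cons_val_one, Matrix.cons_val, ha, hb]
  constructor
  · intro h g hg
    rw [← MvPolynomial.sum_weightedHomogeneousComponent
      (fun ji : Fin 3 × ι => (Pi.single ji.1 1 : Fin 3 → ℕ)) g]
    rw [finsum_eq_sum _ (MvPolynomial.weightedHomogeneousComponent_finsupp g), map_sum]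
    refine Finset.sum_eq_zero fun m _ => ?_
    have hm := MvPolynomial.weightedHomogeneousComponent_isWeightedHomogeneous (R := ℂ)
      (w := fun ji : Fin 3 × ι => (Pi.single ji.1 1 : Fin 3 → ℕ)) m g
    have h1 := h m _ hm (fun a ha => by
      rw [rep_eq_triple]
      exact eval_weightedHomogeneousComponent_eq_zero
        (fun t ht => hg _ (mul_mem_incidenceCone (rep_mem_incidenceCone ha) ht)) m)
    rw [hrep, eval_mul_of_isWeightedHomogeneous hm] at h1
    exact (mul_eq_zero.mp h1).resolve_left
      (Finset.prod_ne_zero_iff.mpr fun j _ => pow_ne_zero _ (ht0 j))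
  · intro h m G hG hGA
    rw [hrep, eval_mul_of_isWeightedHomogeneous hG, h G, mul_zero]
    rintro _ ⟨a, b, c, rfl, ⟨ha0, ha⟩, ⟨hb0, hb⟩, hc, α, β, hcab⟩
    have h1 := hGA ![Projectivization.mk ℂ a ha0, Projectivization.mk ℂ b hb0,
      Projectivization.mk ℂ c hc] ⟨ha, hb, by
        change Projectivization.mk ℂ c hc ∈ linSpan _
        rw [mk_mem_linSpan_iff]
        refine (congrArg (· ∈ Submodule.span ℂ _) hcab).mpr <| Submodule.add_mem _
          (Submodule.smul_mem _ _ (Submodule.subset_span ⟨ha0, by simp⟩))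
          (Submodule.smul_mem _ _ (Submodule.subset_span ⟨hb0, by simp⟩))⟩
    obtain ⟨a', ha'⟩ := Projectivization.exists_smul_eq_mk_rep ℂ a ha0
    obtain ⟨b', hb'⟩ := Projectivization.exists_smul_eq_mk_rep ℂ b hb0
    obtain ⟨c', hc'⟩ := Projectivization.exists_smul_eq_mk_rep ℂ c hc
    rw [Units.smul_def] at ha' hb' hc'
    set t' : Fin 3 → ℂ := ![a', b', c']
    have hrep' : triple (Projectivization.mk ℂ a ha0).rep (Projectivization.mk ℂ b hb0).rep
        (Projectivization.mk ℂ c hc).rep = fun s => t' s.1 * triple a b c s := by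
      rw [triple_smul]
      simp only [t', Matrix.cons_val_zero, Matrix.cons_val_one, Matrix.cons_val, ha', hb', hc']
    rw [rep_eq_triple] at h1
    simp only [Matrix.cons_val_zero, Matrix.cons_val_one, Matrix.cons_val] at h1
    rw [hrep', eval_mul_of_isWeightedHomogeneous hG] at h1
    refine (mul_eq_zero.mp h1).resolve_left (Finset.prod_ne_zero_iff.mpr fun j _ => ?_)
    fin_cases j <;> simp [t']

/-! ### Transfer along places -/

theorem NonProportional.map {R S ι : Type*} [CommRing R] [CommRing S] {f : R →+* S}
    (hf : Function.Injective f) {a b : ι → R} (h : NonProportional a b) :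
    NonProportional (fun i => f (a i)) (fun i => f (b i)) := by
  obtain ⟨i, l, h⟩ := h
  exact ⟨i, l, fun h' => h (hf (by simpa using h'))⟩

section Transfer

variable {Y K : Type} [Field K] [Algebra ℂ K] (φ : (Y → ℂ) →ₐ[ℂ] K)

theorem algHom_symMon {ι : Type} {d : ℕ} (v : ι → Y → ℂ) (m : Sym ι d) :
    φ (fun t => symMon (fun l => v l t) m) = symMon (fun l => φ (v l)) m := by
  have h : (fun t => symMon (fun l => v l t) m) = symMon v m :=
    funext fun t => (map_symMon (Pi.evalRingHom (fun _ : Y => ℂ) t) v m).symm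
  rw [h]
  exact map_symMon (φ : (Y → ℂ) →+* K) v m

theorem algHom_eval {σ : Type} (v : σ → Y → ℂ) (g : MvPolynomial σ ℂ) :
    φ (fun t => MvPolynomial.eval (fun s => v s t) g) =
      MvPolynomial.aeval (fun s => φ (v s)) g := by
  have h : (fun t => MvPolynomial.eval (fun s => v s t) g) = MvPolynomial.aeval v g := by
    funext t
    have : (Pi.evalAlgHom ℂ (fun _ : Y => ℂ) t).comp (MvPolynomial.aeval v) =
        MvPolynomial.aeval (fun s => v s t) := by
      apply MvPolynomial.algHom_ext
      intro s
      simp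
    have := DFunLike.congr_fun this g
    rw [MvPolynomial.aeval_eq_eval] at this
    exact this.symm
  rw [h, ← AlgHom.comp_apply]
  congr 1
  apply MvPolynomial.algHom_ext
  intro s
  simp

/-- The coordinate functions generate the unit ideal of `Y → ℂ`, so `φ` cannot kill all of them.
This keeps the generalized vectors over `K` nonzero. -/
theorem exists_algHom_ne_zero {ι : Type} [Fintype ι] (v : ι → Y → ℂ)
    (hv : ∀ t, ∃ l, v l t ≠ 0) : ∃ l, φ (v l) ≠ 0 := by
  by_contra! hcon
  choose i hi using hv
  classical
  let h : Y → ℂ := ∑ l, (fun t => if i t = l then (v l t)⁻¹ else 0) * v l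
  have h1 : h = 1 := by
    funext t
    simp [h, hi]
  have h2 : φ h = 0 := by simp [h, hcon]
  rw [h1, map_one] at h2
  exact one_ne_zero h2

/-- If a polynomial vanishes along generic values of a family, it vanishes at the specialization. -/
theorem eval_eq_zero_of_place (O : ValuationSubring K) (τ : ℂ →+* O)
    (hτ : ∀ c : ℂ, (τ c : K) = algebraMap ℂ K c) {σ : Type} (V : σ → Y → ℂ) (v : σ → O)
    (hv : ∀ s, (v s : K) = φ (V s)) (p : σ → ℂ)
    (hp : ∀ s, IsLocalRing.residue O (v s) = IsLocalRing.residue O (τ (p s)))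
    (g : MvPolynomial σ ℂ) (h : Y → ℂ) (hφ : φ h ≠ 0)
    (hg : ∀ t, h t * MvPolynomial.eval (fun s => V s t) g = 0) :
    MvPolynomial.eval p g = 0 := by
  -- As `φ h` is invertible, only the parameters `t` with `h t ≠ 0` matter.
  have h1 : φ (fun t => MvPolynomial.eval (fun s => V s t) g) = 0 := by
    refine (mul_eq_zero.mp ?_).resolve_left hφ
    rw [← map_mul, ← map_zero φ]
    exact congrArg φ (funext hg)
  rw [algHom_eval, MvPolynomial.aeval_def, ← funext hv] at h1
  have h2 : MvPolynomial.eval₂ τ v g = 0 := by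
    apply Subtype.val_injective
    refine Eq.trans ?_ h1
    have := MvPolynomial.hom_eval₂ g τ O.subtype v
    rw [ValuationSubring.subtype_apply] at this
    rw [this]
    congr 1
    ext c
    exact hτ c
  have h3 := congrArg (IsLocalRing.residue O) h2
  rw [MvPolynomial.hom_eval₂, map_zero] at h3
  have h4 : (IsLocalRing.residue O).comp τ (MvPolynomial.eval p g) = 0 := by
    rw [← h3, MvPolynomial.eval, MvPolynomial.coe_eval₂Hom, MvPolynomial.hom_eval₂]
    congr 1
    funext s
    exact (hp s).symm
  exact (map_eq_zero _).mp h4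

end Transfer

/-- The coordinates of `x ^ (d - 1) z + ∑ y j ^ d`. -/
noncomputable def tangentSum {ι : Type} {s : ℕ} (d : ℕ) (x z : ι → ℂ) (y : Fin s → ι → ℂ) :
    Sym ι d → ℂ :=
  fun m => tangentMon x z m + ∑ j, symMon (y j) m

/-- If `x ^ (d - 1) z + ∑ y j ^ d` lies in the secant variety, then `z` lies in the tangent star. -/
theorem mem_tangentStar_of_inSecantClosure {ι : Type} [Fintype ι] {d s : ℕ} (hd : 2 * s + 3 ≤ d)
    {X : Set (CProj ι)} {x z : ι → ℂ} (hx0 : x ≠ 0) (hz0 : z ≠ 0) {k₀ : ι} (hx : x k₀ = 1)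
    (hxz : NonProportional x z) {y : Fin s → ι → ℂ} (hy0 : ∀ j, y j ≠ 0)
    (hxy : ∀ j, NonProportional x (y j)) (hy : ∀ i j, i ≠ j → NonProportional (y i) (y j))
    (h : InSecantClosure (s + 2) d X (tangentSum d x z y)) :
    Projectivization.mk ℂ z hz0 ∈ tangentStar X (Projectivization.mk ℂ x hx0) := by
  classical
  -- The parameter space is the cone itself, with a chosen decomposition at each point; no
  -- regularity of the choice is needed since all functions on `Y` are allowed.
  let Y := secantCone (s + 2) d X
  have hYmem : ∀ t : Y, ∃ (c : Fin (s + 2) → ℂ) (y : Fin (s + 2) → ι → ℂ),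
    (∀ i, Represents X (y i)) ∧ t.1 = fun m => ∑ i, c i * symMon (y i) m := fun t => t.2
  choose c v hv hcv using hYmem
  obtain ⟨K, _, _, φ, O, τ, hφ, hτ, hO⟩ := exists_place_residue
    (fun (m : Sym ι d) (t : Y) => t.1 m) (tangentSum d x z y) (fun g hg => h g fun w hw => hg ⟨w, hw⟩)
  choose P hP hPr using hO
  have hinj : Function.Injective ((IsLocalRing.residue O).comp τ) := RingHom.injective _
  have hPsum : ∀ m, (P m : K) =
      ∑ i, φ (fun t => c t i) * symMon (fun l => φ (fun t => v t i l)) m := by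
    intro m
    rw [hP, show (fun t : Y => t.1 m) =
      ∑ i, (fun t => c t i) * (fun t => symMon (fun l => v t i l) m) by
        funext t; rw [hcv t]; simp, map_sum]
    exact Finset.sum_congr rfl fun i _ => by
      rw [map_mul, ← algHom_symMon φ (fun l t => v t i l)]
  obtain ⟨p, q, α, β, α', β', a, b, w, ha, hb, hw, har, hbr, hwr⟩ :=
    exists_line_of_specialization O hd (x := fun l => (IsLocalRing.residue O).comp τ (x l))
      (z := fun l => (IsLocalRing.residue O).comp τ (z l))
      (y := fun j l => (IsLocalRing.residue O).comp τ (y j l)) (k₀ := k₀) (by simp [hx])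
      (hxz.map hinj) (fun j => (hxy j).map hinj) (fun i j hij => (hy i j hij).map hinj)
      (fun j hj => hy0 j (funext fun l => hinj (by simpa using congrFun hj l)))
      _ _ (fun i h0 => by
        obtain ⟨l, hl⟩ := exists_algHom_ne_zero φ (fun l t => v t i l)
          (fun t => Function.ne_iff.mp (hv t i).1)
        exact hl (congrFun h0 l)) P hPsum (fun m => by
        rw [hPr, ← RingHom.comp_apply, tangentSum, map_add, map_sum, map_tangentMon]
        simp only [map_symMon])
  -- Surjectivity of `φ` turns the coefficients of the line over `K` into functions on `Y`, so the
  -- line exists over each parameter.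
  obtain ⟨A, rfl⟩ := hφ α
  obtain ⟨B, rfl⟩ := hφ β
  obtain ⟨A', rfl⟩ := hφ α'
  obtain ⟨B', rfl⟩ := hφ β'
  let a' : ι → Y → ℂ := fun l t => A t * v t p l
  let b' : ι → Y → ℂ := fun l t => B t * v t q l
  let w' : ι → Y → ℂ := fun l t => A' t * a' l t + B' t * b' l t
  have ha' : ∀ l, (a l : K) = φ (a' l) := fun l => by
    rw [ha, ← map_mul]; rfl
  have hb' : ∀ l, (b l : K) = φ (b' l) := fun l => by
    rw [hb, ← map_mul]; rfl
  have hw' : ∀ l, (w l : K) = φ (w' l) := fun l => by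
    rw [hw, ha', hb', ← map_mul, ← map_mul, ← map_add]; rfl
  obtain ⟨i, hi⟩ := Function.ne_iff.mp hz0
  rw [mk_mem_tangentStar_iff]
  intro g hg
  have hne : ∀ (e : O) (r : ℂ), IsLocalRing.residue O e = (IsLocalRing.residue O).comp τ r →
      r ≠ 0 → (e : K) ≠ 0 := by
    intro e r her hr h0
    have : e = 0 := Subtype.ext h0
    rw [this, map_zero] at her
    exact hr (hinj (by rw [← her, map_zero]))
  -- The product `a' k₀ * b' k₀ * w' i` is nonzero in `K`; where it is nonzero at `t`, the three
  -- vectors are nonzero and give an honest element of the incidence cone.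
  refine eval_eq_zero_of_place φ O τ hτ (triple a' b' w') (triple a b w) ?_ _ ?_ g
    (a' k₀ * b' k₀ * w' i) ?_ ?_
  · rintro ⟨j, l⟩
    fin_cases j
    exacts [ha' l, hb' l, hw' l]
  · rintro ⟨j, l⟩
    fin_cases j
    exacts [har l, hbr l, hwr l]
  · rw [map_mul, map_mul, ← ha', ← hb', ← hw']
    exact mul_ne_zero (mul_ne_zero (hne _ _ (har k₀) (by simp [hx])) (hne _ _ (hbr k₀) (by simp [hx])))
      (hne _ _ (hwr i) hi)
  · intro t
    by_cases h0 : (a' k₀ * b' k₀ * w' i) t = 0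
    · rw [h0, zero_mul]
    · refine mul_eq_zero_of_right _ (hg _ ?_)
      have h1 := left_ne_zero_of_mul h0
      have hA : A t ≠ 0 := left_ne_zero_of_mul (left_ne_zero_of_mul h1)
      have hB : B t ≠ 0 := left_ne_zero_of_mul (right_ne_zero_of_mul h1)
      refine ⟨A t • v t p, B t • v t q, fun l => w' l t, ?_, (hv t p).smul hA, (hv t q).smul hB,
        fun hw0 => right_ne_zero_of_mul h0 (congrFun hw0 i), A' t, B' t, rfl⟩
      funext ⟨j, l⟩
      fin_cases j <;> rfl

/-- If `z` lies in the tangent star, then `x ^ (d - 1) z + ∑ y j ^ d` lies in the secant variety. -/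
theorem inSecantClosure_of_mem_tangentStar {ι : Type} [Fintype ι] {d s : ℕ}
    {X : Set (CProj ι)} {x z : ι → ℂ} (hx0 : x ≠ 0) (hz0 : z ≠ 0) {k₀ : ι} (hx : x k₀ = 1)
    (hxz : NonProportional x z) {y : Fin s → ι → ℂ} (hy : ∀ j, Represents X (y j))
    (h : Projectivization.mk ℂ z hz0 ∈ tangentStar X (Projectivization.mk ℂ x hx0)) :
    InSecantClosure (s + 2) d X (tangentSum d x z y) := by
  classical
  rw [mk_mem_tangentStar_iff] at h
  let Y := incidenceCone X
  have hYmem : ∀ t : Y, ∃ a b c, t.1 = triple a b c ∧ Represents X a ∧ Represents X b ∧ c ≠ 0 ∧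
    ∃ α β : ℂ, c = α • a + β • b := fun t => t.2
  choose a' b' c' ht ha' hb' _ A B hAB using hYmem
  obtain ⟨K, _, _, φ, O, τ, hφ, hτ, hO⟩ := exists_place_residue
    (fun (s : Fin 3 × ι) (t : Y) => t.1 s) (triple x x z) (fun g hg => h g fun w hw => hg ⟨w, hw⟩)
  choose P hP hPr using hO
  set κ := (IsLocalRing.residue O).comp τ with hκ
  have hPt : ∀ j l, (P (j, l) : K) = φ (fun t => triple (a' t) (b' t) (c' t) (j, l)) := by
    intro j l
    rw [hP]
    congr 1
    funext t
    rw [ht]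
  set a : ι → O := fun l => P (0, l) with ha
  set b : ι → O := fun l => P (1, l) with hb
  set c : ι → O := fun l => P (2, l) with hc
  have har : ∀ l, IsLocalRing.residue O (a l) = κ (x l) := fun l => hPr (0, l)
  have hbr : ∀ l, IsLocalRing.residue O (b l) = κ (x l) := fun l => hPr (1, l)
  have hcr : ∀ l, IsLocalRing.residue O (c l) = κ (z l) := fun l => hPr (2, l)
  have hφa : ∀ l, (a l : K) = φ (fun t => a' t l) := fun l => hPt 0 l
  have hφb : ∀ l, (b l : K) = φ (fun t => b' t l) := fun l => hPt 1 l
  have hcab : ∀ l, (c l : K) = φ A * a l + φ B * b l := by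
    intro l
    rw [hφa, hφb, ← map_mul, ← map_mul, ← map_add]
    refine (hPt 2 l).trans (congrArg φ (funext fun t => ?_))
    exact congrFun (hAB t) l
  have hunit : ∀ e : O, IsLocalRing.residue O e ≠ 0 → ∃ e', e' * e = 1 := fun e he =>
    isUnit_iff_exists_inv'.mp ((IsLocalRing.residue_ne_zero_iff_isUnit _).mp he)
  obtain ⟨ia, hia⟩ := hunit (a k₀) (by rw [har, hx, map_one]; exact one_ne_zero)
  obtain ⟨ib, hib⟩ := hunit (b k₀) (by rw [hbr, hx, map_one]; exact one_ne_zero)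
  have hiar : IsLocalRing.residue O ia = 1 := by
    have := congrArg (IsLocalRing.residue O) hia
    rwa [map_mul, har, hx, map_one, map_one, mul_one] at this
  have hibr : IsLocalRing.residue O ib = 1 := by
    have := congrArg (IsLocalRing.residue O) hib
    rwa [map_mul, hbr, hx, map_one, map_one, mul_one] at this
  set a₁ : ι → O := fun l => ia * a l with ha₁
  set b₁ : ι → O := fun l => ib * b l with hb₁
  have ha₁r : ∀ l, IsLocalRing.residue O (a₁ l) = κ (x l) := fun l => by
    rw [ha₁, map_mul, hiar, har, one_mul]
  have hb₁r : ∀ l, IsLocalRing.residue O (b₁ l) = κ (x l) := fun l => by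
    rw [hb₁, map_mul, hibr, hbr, one_mul]
  -- Removing the `k₀` coordinate makes `w` a multiple of `b₁ - a₁`, both having coordinate `1`
  -- there. It reduces to `z - z k₀ • x`, which is nonzero because `x` and `z` are not proportional.
  set w : ι → O := fun l => c l - c k₀ * a₁ l with hw
  set β : K := φ B * b k₀ with hβ
  have hiaK : (ia : K) * a k₀ = 1 := congrArg Subtype.val hia
  have hibK : (ib : K) * b k₀ = 1 := congrArg Subtype.val hib
  have hwK : ∀ l, (w l : K) = β * (b₁ l - a₁ l) := by
    intro l
    simp only [hw, ha₁, hb₁, hβ]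
    push_cast
    rw [hcab, hcab]
    linear_combination (-φ A * a l) * hiaK - (φ B * b l) * hibK
  have hwr : ∀ l, IsLocalRing.residue O (w l) = κ (z l - z k₀ * x l) := fun l => by
    rw [hw, map_sub, map_mul, hcr, hcr, ha₁r, map_sub, map_mul]
  obtain ⟨i, hi⟩ : ∃ i, z i - z k₀ * x i ≠ 0 := by
    by_contra! hcon
    obtain ⟨i, l, hil⟩ := hxz
    apply hil
    linear_combination x i * hcon l - x l * hcon i
  obtain ⟨iw, hiw⟩ := hunit (w i) (by rw [hwr]; exact (map_ne_zero κ).mpr hi)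
  have hiwK : (iw : K) * w i = 1 := congrArg Subtype.val hiw
  -- This is the inverse of `β`, and it lies in the maximal ideal: `b₁ = a₁ + γ w` is an
  -- infinitesimal displacement.
  set γ : O := iw * (b₁ i - a₁ i) with hγ
  have hγr : IsLocalRing.residue O γ = 0 := by
    rw [hγ, map_mul, map_sub, ha₁r, hb₁r, sub_self, mul_zero]
  have hβγ : β * γ = 1 := by
    rw [← hiwK, hwK i, hγ]
    push_cast
    ring
  have hb₁a₁ : b₁ = fun l => a₁ l + γ * w l := by
    funext l
    apply Subtype.val_injective
    push_cast
    rw [hwK l]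
    linear_combination (a₁ l - b₁ l : K) * hβγ
  choose e he using fun m : Sym ι d => symMon_add_mul a₁ w γ m
  rw [← hb₁a₁] at he
  -- The combination is `β (b₁ ^ d - a₁ ^ d) + d * c k₀ * a₁ ^ d`: the difference quotient yields
  -- the derivative towards `z - z k₀ • x`, and the last term restores the part along `x` by
  -- `tangentMon_self`.
  obtain ⟨C₁, hC₁⟩ := hφ ((d * c k₀ - β) * ia ^ d)
  obtain ⟨C₂, hC₂⟩ := hφ (β * ib ^ d)
  intro g hg
  have hcoe : ∀ (v : ι → O) (m : Sym ι d), ((symMon v m : O) : K) = symMon (fun l => (v l : K)) m :=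
    fun v m => map_symMon O.subtype v m
  refine eval_eq_zero_of_place φ O τ hτ
    (fun m t => C₁ t * symMon (a' t) m + C₂ t * symMon (b' t) m + ∑ j, symMon (y j) m)
    (fun m => tangentMon a₁ w m + γ * e m + d * c k₀ * symMon a₁ m +
      ∑ j, symMon (fun l => τ (y j l)) m) ?_ _ ?_ g 1 (by simp) ?_
  · intro m
    have h1 : φ (fun t => C₁ t * symMon (a' t) m + C₂ t * symMon (b' t) m +
        ∑ j, symMon (y j) m) =
        φ C₁ * symMon (fun l => (a l : K)) m + φ C₂ * symMon (fun l => (b l : K)) m +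
          algebraMap ℂ K (∑ j, symMon (y j) m) := by
      rw [funext hφa, funext hφb, ← algHom_symMon φ (fun l t => a' t l),
        ← algHom_symMon φ (fun l t => b' t l), ← map_mul, ← map_mul, ← φ.commutes, ← map_add,
        ← map_add]
      rfl
    have h2 : ((symMon a₁ m : O) : K) = ia ^ d * symMon (fun l => (a l : K)) m := by
      rw [hcoe, ← symMon_smul]
      rfl
    have h3 : ((symMon b₁ m : O) : K) = ib ^ d * symMon (fun l => (b l : K)) m := by
      rw [hcoe, ← symMon_smul]
      rfl
    have h4 : ((∑ j, symMon (fun l => τ (y j l)) m : O) : K) =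
        algebraMap ℂ K (∑ j, symMon (y j) m) := by
      rw [← hτ, map_sum]
      simp only [map_symMon]
    have h5 := congrArg (Subtype.val : O → K) (he m)
    push_cast at h5
    rw [h1, hC₁, hC₂, ← h4]
    push_cast
    rw [h2, h3] at h5
    rw [h2]
    linear_combination (-β) * h5 - ((tangentMon a₁ w m : O) + γ * e m : K) * hβγ
  · intro m
    rw [tangentSum]
    simp only [map_add, map_mul, map_sum, hγr, zero_mul, add_zero, map_tangentMon, map_symMon,
      map_natCast, ha₁r, hwr, hcr]
    have h1 := tangentMon_add_mul (fun i => κ (x i)) (fun i => κ (z i)) (fun i => κ (x i))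
      (-κ (z k₀)) m
    rw [tangentMon_self] at h1
    have h2 : (fun i => κ (z i - z k₀ * x i)) = fun i => κ (z i) + -κ (z k₀) * κ (x i) := by
      funext i
      rw [map_sub, map_mul]
      ring
    rw [h2, h1]
    simp only [hκ, RingHom.comp_apply]
    ring
  · intro t
    refine mul_eq_zero_of_right _ (hg _ ⟨Fin.cons (C₁ t) (Fin.cons (C₂ t) fun _ => 1),
      Fin.cons (a' t) (Fin.cons (b' t) y), ?_, ?_⟩)
    · intro i
      refine Fin.cases (ha' t) (fun i => ?_) i
      exact Fin.cases (hb' t) hy i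
    · funext m
      simp [Fin.sum_univ_succ, add_assoc]

/-! ### Tangent stars -/

theorem subset_linSpan {ι : Type} (A : Set (CProj ι)) : A ⊆ linSpan A :=
  Projectivization.Subspace.subset_span A

theorem exists_smul_of_not_nonProportional {ι : Type} {x z : ι → ℂ} {k₀ : ι} (hx : x k₀ = 1)
    (h : ¬ NonProportional x z) : z = z k₀ • x := by
  rw [not_nonProportional_iff] at h
  funext l
  have := h k₀ l
  rw [hx, one_mul] at this
  rw [this, Pi.smul_apply, smul_eq_mul, mul_comm]

theorem mem_tangentStar_self {ι : Type} {X : Set (CProj ι)} {x : CProj ι} (hx : x ∈ X) :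
    x ∈ tangentStar X x := by
  have h := represents_rep hx
  rw [← x.mk_rep, mk_mem_tangentStar_iff]
  exact fun g hg => hg _ ⟨_, _, _, rfl, h, h, x.rep_nonzero, 1, 0, by simp⟩

/-- The point `z` lies on the line joining `x` and `x + t z` for every `t ≠ 0`; let `t` tend to `0`.
-/
theorem mem_tangentStar_univ {ι : Type} (x z : CProj ι) : z ∈ tangentStar Set.univ x := by
  by_cases hzx : x = z
  · subst hzx
    exact mem_tangentStar_self (Set.mem_univ x)
  obtain ⟨i, l, hil⟩ : NonProportional x.rep z.rep := by
    rw [nonProportional_iff_mk_ne x.rep_nonzero z.rep_nonzero, x.mk_rep, z.mk_rep]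
    exact hzx
  rw [← x.mk_rep, ← z.mk_rep, mk_mem_tangentStar_iff]
  have hx := x.rep_nonzero
  have hz := z.rep_nonzero
  clear hzx
  generalize x.rep = a at *
  generalize z.rep = b at *
  intro g hg
  let Q : Polynomial ℂ := MvPolynomial.aeval (triple (fun l => Polynomial.C (a l))
    (fun l => Polynomial.C (a l) + Polynomial.C (b l) * Polynomial.X)
    (fun l => Polynomial.C (b l))) g
  have hQ : ∀ t : ℂ, Q.eval t = MvPolynomial.eval (triple a (a + t • b) b) g := by
    intro t
    have : (Polynomial.aeval t).comp (MvPolynomial.aeval (triple (fun l => Polynomial.C (a l))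
        (fun l => Polynomial.C (a l) + Polynomial.C (b l) * Polynomial.X)
        (fun l => Polynomial.C (b l)))) = MvPolynomial.aeval (triple a (a + t • b) b) := by
      apply MvPolynomial.algHom_ext
      rintro ⟨j, l⟩
      rw [AlgHom.comp_apply, MvPolynomial.aeval_X, MvPolynomial.aeval_X]
      fin_cases j <;> simp [triple, mul_comm t]
    have := DFunLike.congr_fun this g
    rw [MvPolynomial.aeval_eq_eval, AlgHom.comp_apply, Polynomial.coe_aeval_eq_eval] at this
    exact this
  have h0 : Q = 0 := by
    refine polynomial_eq_zero_of_eval_ne_zero fun t ht => ?_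
    rw [hQ]
    refine hg _ ⟨_, _, _, rfl, ⟨hx, Set.mem_univ _⟩, ⟨fun h => hil ?_, Set.mem_univ _⟩, hz,
      -t⁻¹, t⁻¹, ?_⟩
    · have h1 := congrFun h i
      have h2 := congrFun h l
      simp only [Pi.add_apply, Pi.smul_apply, smul_eq_mul, Pi.zero_apply] at h1 h2
      linear_combination b l * h1 - b i * h2
    · rw [smul_add, smul_smul, inv_mul_cancel₀ ht]
      module
  have h1 := hQ 0
  rw [h0, zero_smul, add_zero, Polynomial.eval_zero] at h1
  exact h1.symm

/-- A polynomial `H` vanishing on `X` away from `x` but not at `x` isolates the pair `(x, x)`, and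
over that pair the span is only `x`. The test polynomial is `H(a) H(b) F(c)` with `F` vanishing at
`x` and not at `z`. -/
theorem tangentStar_subset_of_finite {ι : Type} {X : Set (CProj ι)} (hX : X.Finite) (x : CProj ι) :
    tangentStar X x ⊆ {x} := by
  intro z hz
  by_contra hzx
  have hmk : ∀ {p q : CProj ι}, p ≠ q → NonProportional p.rep q.rep := fun {p q} h => by
    rw [nonProportional_iff_mk_ne p.rep_nonzero q.rep_nonzero, p.mk_rep, q.mk_rep]
    exact h
  let minor : (ι → ℂ) → ι → ι → MvPolynomial ι ℂ := fun a i l =>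
    MvPolynomial.C (a i) * MvPolynomial.X l - MvPolynomial.C (a l) * MvPolynomial.X i
  have hminor : ∀ a v i l, MvPolynomial.eval v (minor a i l) = a i * v l - a l * v i := by
    intro a v i l
    simp [minor]
  have hsep : ∀ p q : CProj ι, ∃ F : MvPolynomial ι ℂ,
      (∀ t : ℂ, MvPolynomial.eval (t • p.rep) F = 0) ∧
      (p ≠ q → MvPolynomial.eval q.rep F ≠ 0) := by
    intro p q
    by_cases hpq : p = q
    · exact ⟨0, by simp, fun h => absurd hpq h⟩
    · obtain ⟨i, l, h⟩ := hmk hpq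
      refine ⟨minor p.rep i l, fun t => ?_, fun _ => ?_⟩
      · rw [hminor]
        simp only [Pi.smul_apply, smul_eq_mul]
        ring
      · rw [hminor]
        exact sub_ne_zero.mpr h
  choose F hF hF' using hsep
  let H : MvPolynomial ι ℂ := ∏ p ∈ (hX.subset (Set.sdiff_subset (t := {x}))).toFinset, F p x
  have hH : MvPolynomial.eval x.rep H ≠ 0 := by
    rw [map_prod]
    exact Finset.prod_ne_zero_iff.mpr fun p hp => hF' p x (by
      simp only [Set.Finite.mem_toFinset] at hp
      exact hp.2)
  have hHX : ∀ a, Represents X a → MvPolynomial.eval a H ≠ 0 → ∃ t : ℂ, a = t • x.rep := by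
    intro a ha h
    obtain ⟨p, hp, t, -, rfl⟩ := ha.exists_smul_rep
    by_cases hpx : p = x
    · exact ⟨t, by rw [hpx]⟩
    · refine absurd ?_ h
      rw [map_prod]
      exact Finset.prod_eq_zero (i := p) (by simpa using ⟨hp, hpx⟩) (hF p x t)
  rw [← x.mk_rep, ← z.mk_rep, mk_mem_tangentStar_iff] at hz
  have h1 := hz (MvPolynomial.rename (fun l => (0, l)) H * MvPolynomial.rename (fun l => (1, l)) H *
    MvPolynomial.rename (fun l => (2, l)) (F x z)) (by
      rintro _ ⟨a, b, c, rfl, ha, hb, -, α, β, rfl⟩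
      rw [map_mul, map_mul, MvPolynomial.eval_rename, MvPolynomial.eval_rename,
        MvPolynomial.eval_rename]
      change MvPolynomial.eval a H * MvPolynomial.eval b H *
        MvPolynomial.eval (α • a + β • b) (F x z) = 0
      by_cases h0 : MvPolynomial.eval a H = 0
      · rw [h0, zero_mul, zero_mul]
      by_cases h1 : MvPolynomial.eval b H = 0
      · rw [h1, mul_zero, zero_mul]
      obtain ⟨s, rfl⟩ := hHX a ha h0
      obtain ⟨t, rfl⟩ := hHX b hb h1
      rw [smul_smul, smul_smul, ← add_smul, hF, mul_zero])
  rw [map_mul, map_mul, MvPolynomial.eval_rename, MvPolynomial.eval_rename,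
    MvPolynomial.eval_rename] at h1
  exact mul_ne_zero (mul_ne_zero hH hH) (hF' x z fun h => hzx h.symm) h1

theorem linSpan_singleton {ι : Type} (x : CProj ι) : linSpan {x} = {x} := by
  refine Set.Subset.antisymm (fun z hz => ?_) (subset_linSpan _)
  rw [← z.mk_rep, mk_mem_linSpan_iff] at hz
  have h1 : z.rep ∈ Submodule.span ℂ {x.rep} := by
    refine Submodule.span_le.mpr ?_ hz
    intro w hw
    obtain ⟨p, rfl, t, -, rfl⟩ := Represents.exists_smul_rep hw
    exact Submodule.smul_mem _ _ (Submodule.subset_span rfl)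
  obtain ⟨t, ht⟩ := Submodule.mem_span_singleton.mp h1
  rw [Set.mem_singleton_iff, ← z.mk_rep, ← x.mk_rep, Projectivization.mk_eq_mk_iff']
  exact ⟨t, ht⟩

/-! ### Irreducible components -/

/-- By Zorn's lemma every point lies in a maximal irreducible subset, since unions of chains of
irreducible sets are irreducible. -/
theorem isUnionOfComponents_self {ι : Type} (Z : Set (CProj ι)) : IsUnionOfComponents Z Z := by
  refine ⟨{C | IsIrredComponentOf C Z}, fun C hC => hC, Set.Subset.antisymm (fun z hz => ?_)
    (Set.sUnion_subset fun C (hC : IsIrredComponentOf C Z) => hC.prop.2)⟩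
  obtain ⟨C, hzC, hC⟩ := zorn_subset_nonempty {s : Set (CProj ι) | IsIrreducible s ∧ s ⊆ Z}
    (fun c hc hchain hne => by
      refine ⟨⋃₀ c, ⟨⟨?_, ?_⟩, Set.sUnion_subset fun s hs => (hc hs).2⟩,
        fun s hs => Set.subset_sUnion_of_mem hs⟩
      · obtain ⟨s, hs⟩ := hne
        exact (hc hs).1.nonempty.mono (Set.subset_sUnion_of_mem hs)
      · rintro u v hu hv ⟨a, ⟨s, hs, has⟩, hau⟩ ⟨b, ⟨t, ht, hbt⟩, hbv⟩
        rcases hchain.total hs ht with hst | hts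
        · exact ((hc ht).1.2 u v hu hv ⟨a, hst has, hau⟩ ⟨b, hbt, hbv⟩).mono
            (Set.inter_subset_inter_left _ (Set.subset_sUnion_of_mem ht))
        · exact ((hc hs).1.2 u v hu hv ⟨a, has, hau⟩ ⟨b, hts hbt, hbv⟩).mono
            (Set.inter_subset_inter_left _ (Set.subset_sUnion_of_mem hs)))
    {z} ⟨isIrreducible_singleton, Set.singleton_subset_iff.mpr hz⟩
  exact ⟨C, hC, hzC rfl⟩

theorem exists_form_of_mem_isOpen {ι : Type} {u : Set (CProj ι)} (hu : IsOpen u) {p : CProj ι}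
    (hp : p ∈ u) : ∃ (k : ℕ) (F : MvPolynomial ι ℂ), F.IsHomogeneous k ∧
      MvPolynomial.eval p.rep F ≠ 0 ∧
      ∀ (v : ι → ℂ) (hv : v ≠ 0), MvPolynomial.eval v F ≠ 0 → Projectivization.mk ℂ v hv ∈ u := by
  obtain ⟨S, hS, hSu⟩ := (zariski_isClosed_iff uᶜ).mp hu.isClosed_compl
  have hpS : p ∉ projZeroLocus S := by rw [← hSu]; exact fun h => h hp
  simp only [projZeroLocus, Set.mem_ofPred_eq, not_forall] at hpS
  obtain ⟨F, hFS, hF⟩ := hpS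
  obtain ⟨k, hk⟩ := hS F hFS
  refine ⟨k, F, hk, hF, fun v hv h => ?_⟩
  by_contra hcon
  have h1 : Projectivization.mk ℂ v hv ∈ projZeroLocus S := by rw [← hSu]; exact hcon
  exact h ((vanishesAt_mk hk v hv).mp (h1 F hFS))

/-- Join a point of one open set to a point of the other by a line: nonvanishing of each of the two
forms is a generic condition on it. -/
theorem isIrreducible_linSpan {ι : Type} {A : Set (CProj ι)} (hA : A.Nonempty) :
    IsIrreducible (linSpan A) := by
  refine ⟨hA.mono (subset_linSpan A), ?_⟩
  rintro u v hu hv ⟨p, hpA, hpu⟩ ⟨q, hqA, hqv⟩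
  obtain ⟨k, F, -, hF, hFu⟩ := exists_form_of_mem_isOpen hu hpu
  obtain ⟨l, G, -, hG, hGv⟩ := exists_form_of_mem_isOpen hv hqv
  obtain ⟨i, hi⟩ := Function.ne_iff.mp p.rep_nonzero
  let line : ι → Polynomial ℂ := fun l =>
    Polynomial.C (p.rep l) + Polynomial.X * Polynomial.C (q.rep l - p.rep l)
  have hline : ∀ (H : MvPolynomial ι ℂ) (t : ℂ), (MvPolynomial.aeval line H).eval t =
      MvPolynomial.eval (p.rep + t • (q.rep - p.rep)) H := by
    intro H t
    have : (Polynomial.aeval t).comp (MvPolynomial.aeval line) =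
        MvPolynomial.aeval (p.rep + t • (q.rep - p.rep)) := by
      apply MvPolynomial.algHom_ext
      intro l
      simp [line]
    have := DFunLike.congr_fun this H
    rw [MvPolynomial.aeval_eq_eval, AlgHom.comp_apply, Polynomial.coe_aeval_eq_eval] at this
    exact this
  have hF0 : MvPolynomial.aeval line F ≠ 0 := by
    intro h
    have := hline F 0
    rw [h, Polynomial.eval_zero, zero_smul, add_zero] at this
    exact hF this.symm
  have hG0 : MvPolynomial.aeval line G ≠ 0 := by
    intro h
    have := hline G 1
    rw [h, Polynomial.eval_zero, one_smul, add_sub_cancel] at this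
    exact hG this.symm
  have hi0 : line i ≠ 0 := by
    intro h
    have := congrArg (Polynomial.eval 0) h
    simp [line] at this
    exact hi this
  -- The factor `line i` keeps the vector on the line nonzero.
  obtain ⟨t, ht⟩ : ∃ t, (MvPolynomial.aeval line F * MvPolynomial.aeval line G * line i).eval t ≠ 0 := by
    by_contra! hcon
    exact mul_ne_zero (mul_ne_zero hF0 hG0) hi0 (Polynomial.funext fun t => by simpa using hcon t)
  rw [Polynomial.eval_mul, Polynomial.eval_mul, hline, hline] at ht
  have hw : p.rep + t • (q.rep - p.rep) ≠ 0 := by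
    intro h
    have := congrFun h i
    refine right_ne_zero_of_mul ht ?_
    simpa [line] using this
  refine ⟨Projectivization.mk ℂ _ hw, ?_, hFu _ hw (left_ne_zero_of_mul (left_ne_zero_of_mul ht)),
    hGv _ hw (right_ne_zero_of_mul (left_ne_zero_of_mul ht))⟩
  rw [mk_mem_linSpan_iff]
  have hp := (represents_rep hpA).mk_mem_linSpan
  have hq := (represents_rep hqA).mk_mem_linSpan
  exact Submodule.add_mem _ hp (Submodule.smul_mem _ _ (Submodule.sub_mem _ hq hp))

/-- Here the low degree locus is the whole span, which is irreducible and hence its own only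
component. -/
theorem not_isUnionOfComponents_of_lowDegreeLocus_eq {ι : Type} {q : ℕ} {T : Set (CProj ι)}
    (hT : T.Nonempty) (hTne : T ≠ linSpan T)
    (h : ∀ k ≤ q, ∀ F : MvPolynomial ι ℂ, F.IsHomogeneous k → (∀ t ∈ T, VanishesAt F t) →
      ∀ z ∈ linSpan T, VanishesAt F z) :
    ¬ IsUnionOfComponents T (lowDegreeLocus q T) := by
  have hZ : lowDegreeLocus q T = linSpan T :=
    Set.Subset.antisymm (fun z hz => hz.1) fun z hz => ⟨hz, fun k hk F hF hFT => h k hk F hF hFT z hz⟩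
  rw [hZ]
  rintro ⟨𝒞, h𝒞, hT𝒞⟩
  obtain ⟨t, ht⟩ := hT
  have ht' := ht
  rw [hT𝒞] at ht'
  obtain ⟨C, hC, -⟩ := ht'
  refine hTne (Set.Subset.antisymm (subset_linSpan T) ?_)
  have h1 : linSpan T ⊆ C :=
    (h𝒞 C hC).le_of_ge ⟨isIrreducible_linSpan ⟨t, ht⟩, le_rfl⟩ (h𝒞 C hC).prop.2
  refine h1.trans ?_
  conv_rhs => rw [hT𝒞]
  exact Set.subset_sUnion_of_mem hC

theorem subset_lowDegreeLocus {ι : Type} (q : ℕ) (T : Set (CProj ι)) : T ⊆ lowDegreeLocus q T :=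
  fun t ht => ⟨subset_linSpan T ht, fun _ _ _ _ hF => hF t ht⟩

/-! ### Secant varieties near a tangent star -/

theorem totalDegree_aeval_le {σ ι : Type} {F : MvPolynomial σ ℂ} {k : ℕ} (hF : F.IsHomogeneous k)
    (v : σ → MvPolynomial ι ℂ) (hv : ∀ s, (v s).totalDegree ≤ 1) :
    (MvPolynomial.aeval v F).totalDegree ≤ k := by
  rw [MvPolynomial.aeval_def, MvPolynomial.eval₂_eq]
  refine (MvPolynomial.totalDegree_finsetSum _ _).trans (Finset.sup_le fun m hm => ?_)
  have hdeg : ∑ i ∈ m.support, m i = k := by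
    have := hF (MvPolynomial.mem_support_iff.mp hm)
    simpa [Finsupp.weight_apply, Finsupp.sum] using this
  refine (MvPolynomial.totalDegree_mul _ _).trans ?_
  rw [MvPolynomial.algebraMap_eq, MvPolynomial.totalDegree_C, zero_add, ← hdeg]
  refine (MvPolynomial.totalDegree_finsetProd _ _).trans (Finset.sum_le_sum fun i _ => ?_)
  refine (MvPolynomial.totalDegree_pow _ _).trans ?_
  simpa using Nat.mul_le_mul_left (m i) (hv i)

theorem eval_eq_zero_of_inSecantClosure {ι : Type} {r d : ℕ} (hr : 0 < r) {X : Set (CProj ι)}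
    (hX : X.Nonempty) {w : Sym ι d → ℂ} (hw : InSecantClosure r d X w) {k : ℕ}
    {F : MvPolynomial (Sym ι d) ℂ} (hF : F.IsHomogeneous k)
    (h : ∀ p ∈ secantVariety r (veronese d '' X), VanishesAt F p) : MvPolynomial.eval w F = 0 := by
  have hne : ∀ w : Sym ι d → ℂ, InSecantClosure r d X w → w ≠ 0 → MvPolynomial.eval w F = 0 :=
    fun w hw hw0 => (vanishesAt_mk hF w hw0).mp (h _ ((inSecantClosure_iff hr hX w).mp hw hw0))
  by_cases hw0 : w = 0
  · obtain ⟨x, hx⟩ := hX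
    have h1 := eval_smul_of_isHomogeneous hF 0 (symMon x.rep : Sym ι d → ℂ)
    have h2 := hne (symMon x.rep) (fun g hg => hg _ (symMon_mem_secantCone hr (represents_rep hx)))
      (veroneseVec_ne_zero d x.rep_nonzero)
    rw [h2, mul_zero, zero_smul] at h1
    rw [hw0, h1]
  · exact hne w hw hw0

/-- Vectors `x` and `y j` representing pairwise distinct points of `X`, with `x` normalized. -/
structure PointConfiguration {ι : Type} {s : ℕ} (X : Set (CProj ι)) (x : ι → ℂ) (k₀ : ι)
    (y : Fin s → ι → ℂ) : Prop where
  base : Represents X x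
  normalized : x k₀ = 1
  mem : ∀ j, Represents X (y j)
  base_ne : ∀ j, NonProportional x (y j)
  pairwise_ne : ∀ i j, i ≠ j → NonProportional (y i) (y j)

theorem exists_pointConfiguration {ι : Type} {X : Set (CProj ι)} (hX : X.Infinite) {x : CProj ι}
    (hx : x ∈ X) (s : ℕ) : ∃ (v : ι → ℂ) (hv : v ≠ 0) (k₀ : ι) (y : Fin s → ι → ℂ),
      PointConfiguration X v k₀ y ∧ Projectivization.mk ℂ v hv = x := by
  obtain ⟨k₀, hk₀⟩ := Function.ne_iff.mp x.rep_nonzero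
  have hk : x.rep k₀ ≠ 0 := hk₀
  have hrep := (represents_rep hx).smul (inv_ne_zero hk)
  have hinf : (X \ {x}).Infinite := hX.sdiff (Set.finite_singleton x)
  let e := hinf.natEmbedding
  have hmk : Projectivization.mk ℂ _ hrep.1 = x := by
    conv_rhs => rw [← x.mk_rep]
    rw [Projectivization.mk_eq_mk_iff']
    exact ⟨_, rfl⟩
  refine ⟨_, hrep.1, k₀, fun j => (e j).1.rep,
    ⟨hrep, by simp [hk], fun j => represents_rep (e j).2.1, fun j => ?_, fun i j hij => ?_⟩, hmk⟩
  · rw [nonProportional_iff_mk_ne hrep.1 (e j).1.rep_nonzero, hmk, Projectivization.mk_rep]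
    exact fun h => (e j).2.2 h.symm
  · rw [nonProportional_iff_mk_ne (e i).1.rep_nonzero (e j).1.rep_nonzero, Projectivization.mk_rep,
      Projectivization.mk_rep]
    exact fun h => hij (Fin.ext (e.injective (Subtype.ext h)))

/-- The linear map `z ↦ x ^ (d - 1) z`. -/
noncomputable def tangentMonMap {ι : Type} {d : ℕ} (x : ι → ℂ) : (ι → ℂ) →ₗ[ℂ] (Sym ι d → ℂ) where
  toFun z := tangentMon x z
  map_add' z z' := funext fun m => by
    have := tangentMon_add_mul x z z' 1 m
    simp only [one_mul] at this
    exact this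
  map_smul' c z := funext fun m => by
    have h0 := tangentMon_add_mul x (fun _ => 0) (fun _ => 0) 1 m
    have h1 := tangentMon_add_mul x (fun _ => 0) z c m
    simp only [zero_add, one_mul, mul_zero] at h0 h1
    rw [left_eq_add.mp h0, zero_add] at h1
    exact h1

theorem tangentMon_eq_sum {ι : Type} [Fintype ι] [DecidableEq ι] {d : ℕ} (x z : ι → ℂ)
    (m : Sym ι d) : tangentMon x z m = ∑ l, tangentMon x (Pi.single l 1) m * z l := by
  have h := congrFun (LinearMap.pi_apply_eq_sum_univ (tangentMonMap (d := d) x) z) m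
  rw [Finset.sum_apply] at h
  refine h.trans (Finset.sum_congr rfl fun l _ => ?_)
  rw [Pi.smul_apply, smul_eq_mul, mul_comm]
  congr 1
  change tangentMon x _ m = _
  congr 1
  funext i
  simp [Pi.single_apply, eq_comm]

namespace PointConfiguration

variable {ι : Type} [Fintype ι] {d s : ℕ} {X : Set (CProj ι)} {x : ι → ℂ} {k₀ : ι}
  {y : Fin s → ι → ℂ}

theorem mk_mem_tangentStar_iff (C : PointConfiguration X x k₀ y) (hd : 2 * s + 3 ≤ d)
    {z : ι → ℂ} (hz : z ≠ 0) :
    Projectivization.mk ℂ z hz ∈ tangentStar X (Projectivization.mk ℂ x C.base.1) ↔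
      InSecantClosure (s + 2) d X (tangentSum d x z y) := by
  by_cases hxz : NonProportional x z
  · exact ⟨inSecantClosure_of_mem_tangentStar C.base.1 hz C.normalized hxz C.mem,
      mem_tangentStar_of_inSecantClosure hd C.base.1 hz C.normalized hxz (fun j => (C.mem j).1)
        C.base_ne C.pairwise_ne⟩
  · have hzx := exists_smul_of_not_nonProportional C.normalized hxz
    -- If `z = z k₀ • x`, the tensor is `z k₀ * d` times `x ^ d` plus the powers of the `y j`; the
    -- second copy of `x` has coefficient `0`.
    refine iff_of_true ?_ fun g hg => hg _ ⟨Fin.cons (z k₀ * d) (Fin.cons 0 fun _ => 1),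
      Fin.cons x (Fin.cons x y), ?_, ?_⟩
    · have : Projectivization.mk ℂ z hz = Projectivization.mk ℂ x C.base.1 := by
        rw [Projectivization.mk_eq_mk_iff']
        exact ⟨z k₀, hzx.symm⟩
      rw [this]
      exact mem_tangentStar_self C.base.2
    · intro i
      refine Fin.cases C.base (fun i => ?_) i
      exact Fin.cases C.base C.mem i
    · funext m
      have h1 := tangentMon_add_mul x x x (z k₀ - 1) m
      have h2 : (fun i => x i + (z k₀ - 1) * x i) = z := by
        conv_rhs => rw [hzx]
        funext i
        simp only [Pi.smul_apply, smul_eq_mul]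
        ring
      rw [h2, tangentMon_self] at h1
      simp only [tangentSum, h1, Fin.sum_univ_succ, Fin.cons_zero, Fin.cons_succ, one_mul, zero_mul,
        zero_add]
      ring

/-- For `z` in the span of the tangent star, the tensor lies in `σ_r(v_d(ℙⁿ))` because the tangent
star of `ℙⁿ` is everything, and in `⟨v_d(X)⟩` because `z ↦ x ^ (d - 1) z` is linear and maps the
tangent star into that span. -/
theorem tangentStar_eq_linSpan (C : PointConfiguration X x k₀ y) (hd : 2 * s + 3 ≤ d)
    (h : secantVariety (s + 2) (veronese d '' X) =
      secantVariety (s + 2) (Set.range (veronese d)) ∩ linSpan (veronese d '' X)) :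
    tangentStar X (Projectivization.mk ℂ x C.base.1) =
      linSpan (tangentStar X (Projectivization.mk ℂ x C.base.1)) := by
  set T := tangentStar X (Projectivization.mk ℂ x C.base.1) with hT
  refine Set.Subset.antisymm (subset_linSpan T) fun p hp => ?_
  rw [← p.mk_rep, C.mk_mem_tangentStar_iff hd, inSecantClosure_iff (by omega) ⟨_, C.base.2⟩, h]
  intro hw
  have C' : PointConfiguration Set.univ x k₀ y := ⟨⟨C.base.1, Set.mem_univ _⟩, C.normalized,
    fun j => ⟨(C.mem j).1, Set.mem_univ _⟩, C.base_ne, C.pairwise_ne⟩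
  constructor
  · rw [← Set.image_univ]
    exact (inSecantClosure_iff (by omega) ⟨_, Set.mem_univ (Projectivization.mk ℂ x C.base.1)⟩ _).mp
      ((C'.mk_mem_tangentStar_iff hd p.rep_nonzero).mp (mem_tangentStar_univ _ _)) hw
  · rw [mk_mem_linSpan_iff]
    set W := Submodule.span ℂ {v | Represents (veronese d '' X) v} with hW
    have hsum : (fun m => ∑ j, symMon (y j) m : Sym ι d → ℂ) ∈ W := by
      have : (fun m => ∑ j, symMon (y j) m : Sym ι d → ℂ) = ∑ j, symMon (y j) := by
        funext m; simp
      rw [this]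
      exact Submodule.sum_mem _ fun j _ =>
        Submodule.subset_span (represents_veronese_image (C.mem j))
    have hle : Submodule.span ℂ {v | Represents T v} ≤ W.comap (tangentMonMap x) := by
      rw [Submodule.span_le]
      rintro z ⟨hz, hzT⟩
      have h1 := ((C.mk_mem_tangentStar_iff hd hz).mp hzT).mem_span
      have h2 := Submodule.sub_mem _ h1 hsum
      have h3 : tangentSum d x z y - (fun m => ∑ j, symMon (y j) m) = tangentMonMap x z := by
        funext m
        exact add_sub_cancel_right _ _
      rwa [h3] at h2
    exact Submodule.add_mem _ (hle (represents_rep hp).mk_mem_linSpan) hsum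

theorem lowDegreeLocus_subset_tangentStar (C : PointConfiguration X x k₀ y) (hd : 2 * s + 3 ≤ d)
    {q : ℕ} (h : CutOutInDegreeLE q (secantVariety (s + 2) (veronese d '' X))) :
    lowDegreeLocus q (tangentStar X (Projectivization.mk ℂ x C.base.1)) ⊆
      tangentStar X (Projectivization.mk ℂ x C.base.1) := by
  classical
  obtain ⟨S, hS, hXS⟩ := h
  rintro p ⟨-, hp⟩
  rw [← p.mk_rep, C.mk_mem_tangentStar_iff hd, inSecantClosure_iff (by omega) ⟨_, C.base.2⟩, hXS]
  intro hw F hFS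
  obtain ⟨k, hkq, hF⟩ := hS F hFS
  rw [vanishesAt_mk hF]
  -- The coordinates of the tensor as affine-linear polynomials in `z`; substituting them into `F`
  -- does not raise the degree.
  let v : Sym ι d → MvPolynomial ι ℂ := fun m =>
    (∑ l, MvPolynomial.C (tangentMon x (Pi.single l 1) m) * MvPolynomial.X l) +
      MvPolynomial.C (∑ j, symMon (y j) m)
  have hv : ∀ z m, MvPolynomial.eval z (v m) = tangentSum d x z y m := by
    intro z m
    simp [v, tangentSum, tangentMon_eq_sum x z]
  have hvdeg : ∀ m, (v m).totalDegree ≤ 1 := by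
    intro m
    refine (MvPolynomial.totalDegree_add _ _).trans (max_le ?_
      ((MvPolynomial.totalDegree_C _).le.trans (Nat.zero_le 1)))
    refine (MvPolynomial.totalDegree_finsetSum _ _).trans (Finset.sup_le fun l _ => ?_)
    refine (MvPolynomial.totalDegree_mul _ _).trans ?_
    simp
  have hf : ∀ z, MvPolynomial.eval z (MvPolynomial.aeval v F) =
      MvPolynomial.eval (tangentSum d x z y) F := by
    intro z
    rw [← funext (hv z), MvPolynomial.aeval_def, MvPolynomial.hom_eval₂]
    rw [MvPolynomial.eval, MvPolynomial.coe_eval₂Hom]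
    congr 1
    ext c
    simp
  rw [← hf, ← MvPolynomial.sum_homogeneousComponent (MvPolynomial.aeval v F), map_sum]
  refine Finset.sum_eq_zero fun i hi => ?_
  have hik : i ≤ k := by
    have := totalDegree_aeval_le hF v hvdeg
    have := Finset.mem_range.mp hi
    omega
  -- The pullback of `F` is not homogeneous, but it vanishes on all multiples of vectors
  -- representing the tangent star, so each component does and the low degree equations apply to it.
  refine hp i (hik.trans hkq) _ (MvPolynomial.homogeneousComponent_isHomogeneous i _) fun t ht => ?_
  refine eval_homogeneousComponent_eq_zero (fun c hc => ?_) i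
  rw [hf]
  have ht' := (represents_rep ht).smul hc
  refine eval_eq_zero_of_inSecantClosure (by omega) ⟨_, C.base.2⟩
    ((C.mk_mem_tangentStar_iff hd ht'.1).mp ht'.2) hF fun p hp => ?_
  rw [hXS] at hp
  exact hp F hFS

end PointConfiguration

theorem theorem1p8 (n : ℕ) (X : Set (CProj (Fin (n + 1)))) (hX : IsClosed X)
    (x : CProj (Fin (n + 1))) (hx : IsSingularPoint X x)
    (r : ℕ) (hr : 2 ≤ r) (d : ℕ) (hd : 2 * r - 1 ≤ d) :
    (tangentStar X x ≠ linSpan (tangentStar X x) →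
      secantVariety r (veronese d '' X) ≠
        secantVariety r (Set.range (veronese d)) ∩ linSpan (veronese d '' X)) ∧
    (∀ q : ℕ, ¬ IsUnionOfComponents (tangentStar X x) (lowDegreeLocus q (tangentStar X x)) →
      ¬ CutOutInDegreeLE q (secantVariety r (veronese d '' X))) ∧
    (∀ q : ℕ,
      (∀ k ≤ q, ∀ F : MvPolynomial (Fin (n + 1)) ℂ, F.IsHomogeneous k →
        (∀ t ∈ tangentStar X x, VanishesAt F t) →
          ∀ z ∈ linSpan (tangentStar X x), VanishesAt F z) →
      tangentStar X x ≠ linSpan (tangentStar X x) →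
      ¬ IsUnionOfComponents (tangentStar X x) (lowDegreeLocus q (tangentStar X x))) := by
  have hself := mem_tangentStar_self hx.1
  refine ⟨?_, ?_, fun q hq hne => not_isUnionOfComponents_of_lowDegreeLocus_eq ⟨x, hself⟩ hne hq⟩
  all_goals
    obtain ⟨s, rfl⟩ : ∃ s, r = s + 2 := ⟨r - 2, by omega⟩
    have hd' : 2 * s + 3 ≤ d := by omega
  · intro hne heq
    by_cases hfin : X.Finite
    · have h1 : tangentStar X x = {x} := Set.Subset.antisymm (tangentStar_subset_of_finite hfin x)
        (Set.singleton_subset_iff.mpr hself)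
      rw [h1, linSpan_singleton] at hne
      exact hne rfl
    · obtain ⟨v, hv, k₀, y, C, rfl⟩ := exists_pointConfiguration hfin hx.1 s
      exact hne (C.tangentStar_eq_linSpan hd' heq)
  · intro q hq hcut
    refine hq ?_
    -- Once `Z_q` equals the tangent star, the latter is the union of all components of `Z_q`.
    suffices h : lowDegreeLocus q (tangentStar X x) ⊆ tangentStar X x by
      rw [Set.Subset.antisymm h (subset_lowDegreeLocus q _)]
      exact isUnionOfComponents_self _
    by_cases hfin : X.Finite
    · have h1 : tangentStar X x = {x} := Set.Subset.antisymm (tangentStar_subset_of_finite hfin x)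
        (Set.singleton_subset_iff.mpr hself)
      rw [h1]
      exact fun z hz => (linSpan_singleton x).subset hz.1
    · obtain ⟨v, hv, k₀, y, C, rfl⟩ := exists_pointConfiguration hfin hx.1 s
      exact C.lowDegreeLocus_subset_tangentStar hd' hcut
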